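/- Let $n\ge 1$, $[n]=\{1,\dots,n\}$, $\ell\in[n]$, and let $k$ be a field. Let $B_n$ be the polytope of doubly stochastic $n\times n$ matrices, $C_n=\{u : I+\delta u\in B_n \text{ for all sufficiently small } \delta>0\}$ its supporting cone at the identity, $\overline C_n\subset W_n=\mathbb R^{(n-1)\times(n-1)}$ the image of $C_n$ under deletion of the last row and last column, and $\overline D_n=\{y\in W_n : \langle x,y\rangle\ge 0\ \forall x\in\overline C_n\}$ its dual cone. For $i\ne j$ in $[n]$ let $\overline M_{i,j}\in W_n$ be the matrix unit at $(i,j)$ if $i,j\neq n$; the matrix with $i$-th row all $-1$ and zeros elsewhere if $j=n$; and the matrix with $j$-th column all $-1$ and zeros elsewhere if $i=n$. Let $\mathcal M=(\overline M_{i,j})_{i\ne j}$, regarded as a family indexed by the pairs $(i,j)$. Let $\mathbf{Arb}(\ell,n)$ be the set of directed spanning trees $T$ on $[n]$ with all edges pointing away from the root $\ell$, with edge set $E(T)$, and put $\overline D_T=\operatorname{cone}\{\overline M_{i,j} : i\ne j,\ (i,j)\notin E(T)\}$. Let $I_{\mathcal M}\subset k[x_{i,j}: i\neq j]$ be the toric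 ideal of $\mathcal M$, generated by all $x^{u^+}-x^{u^-}$ with $u\in\mathbb Z^{n(n-1)}$, $\sum u_{i,j}\overline M_{i,j}=0$. For a partition $[n]=S\sqcup S'$ into nonempty parts let $P_{S,S'}=\prod_{s\in S,t\in S'}x_{s,t}-\prod_{s\in S,t\in S'}x_{t,s}$, and let $Gr_\ell$ be the set of all $P_{S,S'}$ with $\ell\in S$. Say that a term order is *adapted to* $\ell$ if the initial monomial of $P_{S,S'}$ is $\prod_{s\in S,t\in S'}x_{s,t}$ for every such partition with $\ell\in S$. Proposition. (1) $\overline D_n=\operatorname{cone}(\mathcal M)$. The cones $\overline D_T$, $T\in\mathbf{Arb}(\ell,n)$, are pairwise distinct and are the maximal cones of a triangulation of $\overline D_n$: there are finitely many of them, each is simplicial and spans the same linear space as $\overline D_n$, their union is $\overline D_n$, any two meet in a common face, and any two distinct ones have disjoint (relative) interiors. (2) Each $\overline D_T$ is unimodular: it is generated by linearly independent vectors forming a $\mathbb Z$-basis of the lattice of integer points of its linear span. (3) The triangulation is the one induced by the Gröbner basis $Gr_\ell$: (a) $Gr_\ell$ is a Gröbner basis of $I_{\mathcal M}$ for every term order;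 (b) every term order in which each variable $x_{\ell,j}$ is larger than all monomials in the variables $x_{i,k}$ with $i\ne\ell$ is adapted to $\ell$, and such term orders exist; (c) for every term order adapted to $\ell$, a set $\sigma$ of pairs satisfies $\prod_{(i,j)\in\sigma}x_{i,j}\notin\sqrt{\operatorname{in}(I_{\mathcal M})}$ if and only if $\sigma\cap E(T)=\emptyset$ for some $T\in\mathbf{Arb}(\ell,n)$; (d) for every weight vector $w\in\mathbb R^{n(n-1)}$ such that $\sum_{s\in S,t\in S'}w_{s,t}>\sum_{s\in S,t\in S'}w_{t,s}$ for all partitions $[n]=S\sqcup S'$ into nonempty parts with $\ell\in S$, the cells of the regular subdivision of $\mathcal M$ with heights $w$ are exactly the sets $\sigma$ of pairs with $\sigma\cap E(T)=\emptyset$ for some $T\in\mathbf{Arb}(\ell,n)$. Here $\sigma$ is a cell if there is an affine function $h$ on $W_n$ with $h(\overline M_{i,j})\le w_{i,j}$ for all $i\ne j$ and equality exactly for $(i,j)\in\sigma$. -/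

import Mathlib

open scoped MonomialOrder Topology

noncomputable section

namespace BirkhoffCone

/-! Throughout, the node set `[n]` with `n = m + 1` is `Fin (m + 1)`, and the node called `n`
is `Fin.last m`. -/

/-- Ordered pairs `(i, j)` of distinct nodes, i.e. directed edges of the complete graph. -/
abbrev Edge (m : ℕ) : Type := {e : Fin (m + 1) × Fin (m + 1) // e.1 ≠ e.2}

/-- The space `W_n` of real `(n - 1) × (n - 1)` matrices. -/
abbrev W (m : ℕ) : Type := Matrix (Fin m) (Fin m) ℝ

/-! ### The supporting cone of the Birkhoff polytope at the identity, and its dual -/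

/-- The supporting cone of a set `P` at `v`: all `u` with `v + δ u ∈ P` for all sufficiently
small `δ > 0`. -/
def supportingCone {E : Type*} [AddCommGroup E] [Module ℝ E] (P : Set E) (v : E) : Set E :=
  {u | ∀ᶠ δ : ℝ in 𝓝[>] 0, v + δ • u ∈ P}

/-- Deleting the last row and the last column. -/
def proj (m : ℕ) (A : Matrix (Fin (m + 1)) (Fin (m + 1)) ℝ) : W m :=
  A.submatrix Fin.castSucc Fin.castSucc

/-- The dot product of matrices. -/
def dot (m : ℕ) : W m →ₗ[ℝ] W m →ₗ[ℝ] ℝ :=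
  LinearMap.mk₂ ℝ (fun A B => ∑ i, ∑ j, A i j * B i j)
    (by intro A A' B; simp [add_mul, Finset.sum_add_distrib])
    (by intro c A B; simp [mul_assoc, Finset.mul_sum])
    (by intro A B B'; simp [mul_add, Finset.sum_add_distrib])
    (by intro c A B; simp [mul_left_comm, Finset.mul_sum])

/-- The supporting cone of the polytope of doubly stochastic matrices at the identity, projected
to the space `W m`. -/
def projectedCone (m : ℕ) : Set (W m) :=
  proj m '' supportingCone
    (doublyStochastic ℝ (Fin (m + 1)) : Set (Matrix (Fin (m + 1)) (Fin (m + 1)) ℝ)) 1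

/-- The dual of the projected supporting cone inside `W m`. -/
def dualCone (m : ℕ) : PointedCone ℝ (W m) :=
  PointedCone.dual (dot m) (projectedCone m)

/-! ### The vector configuration and arborescences -/

/-- The vector of the configuration attached to the pair `(i, j)`: for `i, j ≠ n` it is the
matrix unit at `(i, j)`; for `j = n` its `i`-th row is `-1` and the rest is `0`; for `i = n` its
`j`-th column is `-1` and the rest is `0`. -/
def ray {m : ℕ} (e : Edge m) : Matrix (Fin m) (Fin m) ℤ := fun a b =>
  if e.1.2 = Fin.last m then (if e.1.1 = a.castSucc then -1 else 0)
  else if e.1.1 = Fin.last m then (if e.1.2 = b.castSucc then -1 else 0)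
  else (if e.1.1 = a.castSucc ∧ e.1.2 = b.castSucc then 1 else 0)

/-- The same vector with real entries. -/
def rayR {m : ℕ} (e : Edge m) : W m := (ray e).map (fun z : ℤ => (z : ℝ))

/-- `T` is (the edge set of) a directed spanning tree with all edges pointing away from the
root `ℓ`. -/
structure IsArborescence {m : ℕ} (ℓ : Fin (m + 1)) (T : Finset (Edge m)) : Prop where
  /-- the root has no parent -/
  root : ∀ e ∈ T, e.1.2 ≠ ℓ
  /-- every other node has exactly one parent -/
  parent : ∀ v, v ≠ ℓ → ∃! e : Edge m, e ∈ T ∧ e.1.2 = v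
  /-- every node is reached from the root along edges of `T` -/
  reach : ∀ v, Relation.ReflTransGen (fun i j => ∃ e ∈ T, e.1 = (i, j)) ℓ v

/-- The set of all `ℓ`-arborescences. -/
def Arb {m : ℕ} (ℓ : Fin (m + 1)) : Set (Finset (Edge m)) := {T | IsArborescence ℓ T}

/-- The cone generated by the vectors of the configuration whose index is not in `T`. -/
def coneD {m : ℕ} (T : Finset (Edge m)) : PointedCone ℝ (W m) :=
  PointedCone.hull ℝ (rayR '' {e | e ∉ T})

/-! ### Triangulations of cones, unimodular cones -/

/-- `F` is the set of maximal cones of a triangulation of the cone `C`. -/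
structure IsTriangulation {E : Type*} [AddCommGroup E] [Module ℝ E] [TopologicalSpace E]
    (C : PointedCone ℝ E) (F : Set (PointedCone ℝ E)) : Prop where
  finite : F.Finite
  simplicial : ∀ K ∈ F, K.IsSimplicial
  full_dim : ∀ K ∈ F, Submodule.span ℝ (K : Set E) = Submodule.span ℝ (C : Set E)
  cover : ⋃ K ∈ F, (K : Set E) = (C : Set E)
  inter_face : ∀ K ∈ F, ∀ L ∈ F, (K ⊓ L).IsFaceOf K
  disjoint_interior : ∀ K ∈ F, ∀ L ∈ F, K ≠ L →
    Disjoint (intrinsicInterior ℝ (K : Set E)) (intrinsicInterior ℝ (L : Set E))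

/-- A cone generated by linearly independent vectors that form a `ℤ`-basis of the lattice of
integer points in its linear span. -/
def IsUnimodular {m : ℕ} (K : PointedCone ℝ (W m)) : Prop :=
  ∃ (d : ℕ) (r : Fin d → W m), LinearIndependent ℝ r ∧
    PointedCone.hull ℝ (Set.range r) = K ∧
    (Submodule.span ℤ (Set.range r) : Set (W m)) =
      {A | A ∈ Submodule.span ℝ (K : Set (W m)) ∧
        ∃ B : Matrix (Fin m) (Fin m) ℤ, A = B.map (fun z : ℤ => (z : ℝ))}

/-! ### Toric ideals, Gröbner bases and the complexes they induce -/

section Groebner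

open MvPolynomial

variable {σ : Type*} {k : Type*} [Field k]

/-- The toric ideal of a finite configuration `a` of integer vectors, generated by the
binomials `x^{u⁺} - x^{u⁻}` with `u a = 0`. -/
def toricIdeal [Fintype σ] {L : Type*} [AddCommGroup L] (k : Type*) [Field k] (a : σ → L) :
    Ideal (MvPolynomial σ k) :=
  Ideal.span {f | ∃ u : σ → ℤ, ∑ i, u i • a i = 0 ∧
    f = ∏ i, X i ^ (u i).toNat - ∏ i, X i ^ (-u i).toNat}

/-- The ideal generated by the initial monomials of the nonzero members of a set of
polynomials. -/
def initialSpan (ord : MonomialOrder σ) (G : Set (MvPolynomial σ k)) : Ideal (MvPolynomial σ k) :=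
  Ideal.span {p | ∃ f ∈ G, f ≠ 0 ∧ p = monomial (ord.degree f) 1}

/-- `G` is a Gröbner basis of `I`: a finite subset of `I` whose initial monomials generate the
initial ideal of `I`. -/
def IsGroebnerBasis (ord : MonomialOrder σ) (I : Ideal (MvPolynomial σ k))
    (G : Set (MvPolynomial σ k)) : Prop :=
  G.Finite ∧ G ⊆ I ∧ initialSpan ord G = initialSpan ord (I : Set (MvPolynomial σ k))

/-- The simplicial complex whose non-faces are the index sets of the squarefree monomials in the
radical of the initial ideal of `I`. -/
def initialComplex (ord : MonomialOrder σ) (I : Ideal (MvPolynomial σ k)) : Set (Finset σ) :=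
  {s | ∏ i ∈ s, X i ∉ (initialSpan ord (I : Set (MvPolynomial σ k))).radical}

end Groebner

/-- The edges directed from `S` to its complement. -/
def cut {m : ℕ} (S : Finset (Fin (m + 1))) : Finset (Edge m) :=
  Finset.univ.filter fun e => e.1.1 ∈ S ∧ e.1.2 ∉ S

/-- The binomial `P_{S,T}` with `T` the complement of `S`. -/
def cutBinomial {m : ℕ} (k : Type*) [Field k] (S : Finset (Fin (m + 1))) :
    MvPolynomial (Edge m) k :=
  ∏ e ∈ cut S, MvPolynomial.X e - ∏ e ∈ cut Sᶜ, MvPolynomial.X e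

/-- The set `Gr_ℓ` of all `P_{S,T}`, for the partitions of the node set into two nonempty parts
`S` and `T` with `ℓ ∈ S`. -/
def Gr {m : ℕ} (k : Type*) [Field k] (ℓ : Fin (m + 1)) : Set (MvPolynomial (Edge m) k) :=
  {f | ∃ S : Finset (Fin (m + 1)), ℓ ∈ S ∧ S ≠ Finset.univ ∧ f = cutBinomial k S}

/-- Every variable `x_{ℓ,j}` exceeds all monomials in the variables `x_{i,k}` with `i ≠ ℓ`. -/
def RootDominates {m : ℕ} (ord : MonomialOrder (Edge m)) (ℓ : Fin (m + 1)) : Prop :=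
  ∀ e : Edge m, e.1.1 = ℓ → ∀ a : Edge m →₀ ℕ, (∀ f ∈ a.support, f.1.1 ≠ ℓ) →
    a ≺[ord] Finsupp.single e 1

/-- For every partition into nonempty `S ∋ ℓ` and `T`, the initial monomial of `P_{S,T}` is the
product of the `x_{s,t}` with `s ∈ S` and `t ∈ T`. -/
def SelectsOutgoing {m : ℕ} (k : Type*) [Field k] (ord : MonomialOrder (Edge m))
    (ℓ : Fin (m + 1)) : Prop :=
  ∀ S : Finset (Fin (m + 1)), ℓ ∈ S → S ≠ Finset.univ →
    ord.degree (cutBinomial k S) = ∑ e ∈ cut S, Finsupp.single e 1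

/-- The cells of the regular subdivision of the configuration induced by the heights `w`: the
index sets of the lifted points on which an affine function is tight, among the affine functions
lying weakly below all lifted points. -/
def regularCells {m : ℕ} (w : Edge m → ℝ) : Set (Finset (Edge m)) :=
  {s | ∃ (c : W m) (c₀ : ℝ), (∀ e, dot m c (rayR e) - c₀ ≤ w e) ∧
    ∀ e, dot m c (rayR e) - c₀ = w e ↔ e ∈ s}

/-- The cells, of all dimensions, of the triangulation `Tri_ℓ`: the index sets contained in the
complement of some `ℓ`-arborescence. -/
def triCells {m : ℕ} (ℓ : Fin (m + 1)) : Set (Finset (Edge m)) :=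
  {s | ∃ T ∈ Arb ℓ, Disjoint s T}

end BirkhoffCone

end

open BirkhoffCone

/-!
The linear relations `∑ u_{i,j} M_{i,j} = 0` of the configuration are exactly the coboundaries
`u_{i,j} = p_i - p_j` of functions `p` on the nodes, over `ℤ` and over `ℝ`
(`sum_mul_ray_eq_zero_iff`). Everything reduces to potentials and cuts of the complete digraph.

*Combinatorics.* An edge set contains an `ℓ`-arborescence if and only if it has an edge out of every
proper node set containing `ℓ` (`isSpanning_iff`): a minimal edge set with this property is an
arborescence, by submodularity of cuts. Thus a set of edges is a cell of the triangulation if and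
only if it contains no cut directed away from `ℓ`.

*Triangulation.* A nonnegative coefficient vector can be changed by a potential to a nonnegative one
whose zero set contains an arborescence: choose the largest admissible potential
(`exists_isSpanning_zero`). By the maximum principle such an expression of a point is unique
(`coeff_unique`). The first fact says that the cones of the arborescences cover the cone of the
configuration; the second one gives common faces and disjoint interiors, and the same argument shows
that the cones are simplicial (`eq_zero_of_comb_eq_zero`). Since
potentials with prescribed differences along an arborescence exist over `ℤ`, the cones are
unimodular. The projected supporting cone is cut out by the inequalities given by the
configuration, hence its dual is the cone of the configuration, which is closed because it is a
finite union of simplicial cones.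

*Regular subdivision.* Functions on the edges that extend to affine functions on the matrix space
are the circulations. So a cell is the zero set of a nonnegative flow with the same excesses as the
weight vector. Positivity of the excesses of all node sets avoiding `ℓ` forces the support of such
a flow to be spanning, and every edge set containing an arborescence is a support
(`IsArborescence.exists_flow`).

*Gröbner basis.* A nonzero element of the toric ideal has, besides its leading monomial, another
monomial of the same degree in the grading by the configuration. The two differ by a coboundary
`p_i - p_j`, and decomposing it into the cuts at the level sets of `p` yields a cut binomial whose
leading monomial divides the given one (`exists_cut_le`).
-/

namespace BirkhoffCone

variable {m : ℕ}

/-! ### Spanning edge sets and arborescences -/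

@[simp] lemma mem_cut {S : Finset (Fin (m + 1))} {e : Edge m} :
    e ∈ cut S ↔ e.1.1 ∈ S ∧ e.1.2 ∉ S := by
  simp [cut]

/-- Every node is reachable from `ℓ` along `G`, expressed by cuts: an edge of `G` leaves each
proper node set that contains `ℓ`. -/
def IsSpanning (ℓ : Fin (m + 1)) (G : Finset (Edge m)) : Prop :=
  ∀ S : Finset (Fin (m + 1)), ℓ ∈ S → S ≠ Finset.univ → ∃ e ∈ G, e ∈ cut S

lemma IsSpanning.mono {ℓ : Fin (m + 1)} {G H : Finset (Edge m)} (hG : IsSpanning ℓ G)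
    (h : G ⊆ H) : IsSpanning ℓ H := fun S h1 h2 =>
  let ⟨e, he, hc⟩ := hG S h1 h2
  ⟨e, h he, hc⟩

lemma IsArborescence.isSpanning {ℓ : Fin (m + 1)} {T : Finset (Edge m)}
    (hT : IsArborescence ℓ T) : IsSpanning ℓ T := by
  intro S hS hne
  by_contra! hcon
  refine hne (Finset.eq_univ_of_forall fun v => ?_)
  induction hT.reach v with
  | refl => exact hS
  | tail _ h ih =>
    obtain ⟨e, he, heq⟩ := h
    have := hcon e he
    rw [mem_cut, heq] at this
    by_contra h'
    exact this ⟨ih, h'⟩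

/-- The set of all nodes arises from `{ℓ}` by repeatedly adding the head of an edge of a spanning
set `G` whose tail is already present. -/
lemma IsSpanning.induction {ℓ : Fin (m + 1)} {G : Finset (Edge m)} (hG : IsSpanning ℓ G)
    {P : Finset (Fin (m + 1)) → Prop} (base : P {ℓ})
    (step : ∀ S, ℓ ∈ S → P S → ∀ e ∈ G, e ∈ cut S → P (insert e.1.2 S)) :
    P Finset.univ := by
  classical
  let F : Finset (Finset (Fin (m + 1))) := Finset.univ.filter fun S => ℓ ∈ S ∧ P S
  obtain ⟨S, hS, hmax⟩ := F.exists_max_image Finset.card ⟨{ℓ}, by simp [F, base]⟩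
  simp only [F, Finset.mem_filter, Finset.mem_univ, true_and] at hS hmax
  by_cases h : S = Finset.univ
  · exact h ▸ hS.2
  · obtain ⟨e, he, hc⟩ := hG S hS.1 h
    have := hmax _ ⟨Finset.mem_insert_of_mem hS.1, step S hS.1 hS.2 e he hc⟩
    rw [Finset.card_insert_of_notMem (mem_cut.1 hc).2] at this
    omega

/-- A minimal spanning set is an arborescence. If two edges `e`, `f` of it entered the same node,
then `e` would be the only edge leaving some `S`, and `f` the only one leaving some `S'`; these
would be the only candidates for an edge leaving `S ∩ S'`, and neither of them does. -/
lemma IsSpanning.exists_arborescence {ℓ : Fin (m + 1)} {G : Finset (Edge m)}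
    (hG : IsSpanning ℓ G) : ∃ T ∈ Arb ℓ, T ⊆ G := by
  classical
  obtain ⟨T, hTG, hmin⟩ := exists_minimal_le_of_wellFoundedLT (IsSpanning ℓ) G hG
  refine ⟨T, ?_, hTG⟩
  have hT : IsSpanning ℓ T := hmin.prop
  -- by minimality, each edge of `T` is the only one leaving some node set
  have herase : ∀ e ∈ T, ∃ S : Finset (Fin (m + 1)), ℓ ∈ S ∧ S ≠ Finset.univ ∧ e ∈ cut S ∧
      ∀ f ∈ T, f ∈ cut S → f = e := by
    intro e he
    have hn : ¬ IsSpanning ℓ (T.erase e) := fun h =>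
      Finset.notMem_erase e T (hmin.le_of_le h (Finset.erase_subset e T) he)
    simp only [IsSpanning, not_forall, not_exists, not_and] at hn
    obtain ⟨S, hS, hne, hcon⟩ := hn
    have huniq : ∀ f ∈ T, f ∈ cut S → f = e := fun f hf hc => by
      by_contra hfe
      exact hcon f (Finset.mem_erase.2 ⟨hfe, hf⟩) hc
    obtain ⟨f, hf, hc⟩ := hT S hS hne
    exact ⟨S, hS, hne, huniq f hf hc ▸ hc, huniq⟩
  refine ⟨?_, ?_, ?_⟩
  · intro e he hcon
    obtain ⟨S, hS, -, hc, -⟩ := herase e he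
    exact (mem_cut.1 hc).2 (hcon ▸ hS)
  · intro v hv
    obtain ⟨e, he, hc⟩ := hT {v}ᶜ (by simpa using hv.symm) (by
      intro h
      have : v ∈ ({v}ᶜ : Finset (Fin (m + 1))) := h ▸ Finset.mem_univ v
      simp at this)
    have hev : e.1.2 = v := by simpa using (mem_cut.1 hc).2
    refine ⟨e, ⟨he, hev⟩, ?_⟩
    rintro f ⟨hf, hfv⟩
    by_contra hfe
    obtain ⟨S, hS, -, heS, hSu⟩ := herase e he
    obtain ⟨S', hS', -, hfS', hSu'⟩ := herase f hf
    rw [mem_cut] at heS hfS'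
    have hfS : f.1.1 ∉ S := fun h => hfe (hSu f hf (mem_cut.2 ⟨h, by rw [hfv, ← hev]; exact heS.2⟩))
    have heS' : e.1.1 ∉ S' := fun h =>
      hfe (hSu' e he (mem_cut.2 ⟨h, by rw [hev, ← hfv]; exact hfS'.2⟩)).symm
    obtain ⟨g, hg, hgc⟩ := hT (S ∩ S') (Finset.mem_inter.2 ⟨hS, hS'⟩) (fun h =>
      hfS (Finset.mem_inter.1 (h ▸ Finset.mem_univ f.1.1)).1)
    rw [mem_cut, Finset.mem_inter, Finset.mem_inter, not_and_or] at hgc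
    rcases hgc.2 with h | h
    · exact heS' (hSu g hg (mem_cut.2 ⟨hgc.1.1, h⟩) ▸ hgc.1.2)
    · exact hfS (hSu' g hg (mem_cut.2 ⟨hgc.1.2, h⟩) ▸ hgc.1.1)
  · intro v
    let R : Finset (Fin (m + 1)) := Finset.univ.filter fun v =>
      Relation.ReflTransGen (fun i j => ∃ e ∈ T, e.1 = (i, j)) ℓ v
    have hR : R = Finset.univ := by
      by_contra hne
      obtain ⟨e, he, hc⟩ := hT R (by simp [R, Relation.ReflTransGen.refl]) hne
      simp only [mem_cut, R, Finset.mem_filter, Finset.mem_univ, true_and] at hc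
      exact hc.2 (hc.1.tail ⟨e, he, rfl⟩)
    have : v ∈ R := hR ▸ Finset.mem_univ v
    simpa [R] using this

lemma isSpanning_iff {ℓ : Fin (m + 1)} {G : Finset (Edge m)} :
    IsSpanning ℓ G ↔ ∃ T ∈ Arb ℓ, T ⊆ G :=
  ⟨IsSpanning.exists_arborescence, fun ⟨_, hT, h⟩ => (IsArborescence.isSpanning hT).mono h⟩

lemma mem_triCells_iff {ℓ : Fin (m + 1)} {s : Finset (Edge m)} :
    s ∈ triCells ℓ ↔ IsSpanning ℓ sᶜ := by
  rw [isSpanning_iff]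
  refine exists_congr fun T => and_congr_right fun _ => ?_
  rw [← Finset.subset_compl_iff_disjoint_left]

lemma IsArborescence.eq_of_subset {ℓ : Fin (m + 1)} {T T' : Finset (Edge m)}
    (hT : IsArborescence ℓ T) (hT' : IsArborescence ℓ T') (h : T ⊆ T') : T = T' := by
  refine h.antisymm fun e he => ?_
  obtain ⟨f, ⟨hf, hfe⟩, -⟩ := hT.parent e.1.2 (hT'.root e he)
  rwa [(hT'.parent e.1.2 (hT'.root e he)).unique ⟨he, rfl⟩ ⟨h hf, hfe⟩]

/-- The differences of a potential along the edges of an arborescence can be prescribed. -/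
lemma IsArborescence.exists_potential {A : Type*} [AddCommGroup A] {ℓ : Fin (m + 1)}
    {T : Finset (Edge m)} (hT : IsArborescence ℓ T) (z : Edge m → A) :
    ∃ p : Fin (m + 1) → A, ∀ e ∈ T, p e.1.2 = p e.1.1 + z e := by
  classical
  suffices h : ∃ p : Fin (m + 1) → A, ∀ e ∈ T, e.1.2 ∈ (Finset.univ : Finset (Fin (m + 1))) →
      e.1.1 ∈ (Finset.univ : Finset (Fin (m + 1))) ∧ p e.1.2 = p e.1.1 + z e by
    obtain ⟨p, hp⟩ := h
    exact ⟨p, fun e he => (hp e he (Finset.mem_univ _)).2⟩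
  refine hT.isSpanning.induction (P := fun S => ∃ p : Fin (m + 1) → A, ∀ e ∈ T, e.1.2 ∈ S →
    e.1.1 ∈ S ∧ p e.1.2 = p e.1.1 + z e)
    ⟨0, fun e he h => absurd (Finset.mem_singleton.1 h) (hT.root e he)⟩ ?_
  rintro S hS ⟨p, hp⟩ e he hc
  rw [mem_cut] at hc
  refine ⟨Function.update p e.1.2 (p e.1.1 + z e), fun f hf h => ?_⟩
  by_cases hfe : f.1.2 = e.1.2
  · obtain rfl : f = e := (hT.parent e.1.2 (hT.root e he)).unique ⟨hf, hfe⟩ ⟨he, rfl⟩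
    exact ⟨Finset.mem_insert_of_mem hc.1, by
      rw [Function.update_self, Function.update_of_ne f.2]⟩
  · obtain ⟨h1, h2⟩ := hp f hf ((Finset.mem_insert.1 h).resolve_left hfe)
    refine ⟨Finset.mem_insert_of_mem h1, ?_⟩
    rw [Function.update_of_ne hfe, Function.update_of_ne (fun h : f.1.1 = e.1.2 => hc.2 (h ▸ h1)), h2]

/-! ### Linear relations of the configuration -/

/-- A function on the edges as a square matrix with zero diagonal. -/
def toMatrix {R : Type*} [Zero R] (u : Edge m → R) (i j : Fin (m + 1)) : R :=
  if h : i ≠ j then u ⟨(i, j), h⟩ else 0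

@[simp] lemma toMatrix_self {R : Type*} [Zero R] (u : Edge m → R) (i : Fin (m + 1)) :
    toMatrix u i i = 0 := by simp [toMatrix]

lemma toMatrix_edge {R : Type*} [Zero R] (u : Edge m → R) (e : Edge m) :
    toMatrix u e.1.1 e.1.2 = u e := dif_pos e.2

lemma sum_ite_edge {R : Type*} [AddCommMonoid R] (u : Edge m → R) (i j : Fin (m + 1)) :
    ∑ e : Edge m, (if e.1 = (i, j) then u e else 0) = toMatrix u i j := by
  by_cases h : i = j
  · subst h
    rw [toMatrix_self]
    refine Finset.sum_eq_zero fun e _ => if_neg fun h => e.2 ?_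
    rw [h]
  · rw [toMatrix, dif_pos h, Finset.sum_eq_single (⟨(i, j), h⟩ : Edge m)]
    · simp
    · intro e _ he
      exact if_neg fun h' => he (Subtype.ext h')
    · simp

lemma ray_apply (e : Edge m) (a b : Fin m) :
    ray e a b = (if e.1 = (a.castSucc, b.castSucc) then 1 else 0)
      - (if e.1 = (a.castSucc, Fin.last m) then 1 else 0)
      - (if e.1 = (Fin.last m, b.castSucc) then 1 else 0) := by
  obtain ⟨⟨i, j⟩, hij⟩ := e
  have ha : Fin.last m ≠ a.castSucc := (Fin.castSucc_lt_last a).ne'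
  have hb : Fin.last m ≠ b.castSucc := (Fin.castSucc_lt_last b).ne'
  simp only [ray, Prod.mk.injEq]
  dsimp only at hij
  by_cases h1 : j = Fin.last m
  · subst h1
    simp [hb, apply_ite Neg.neg]
  · by_cases h2 : i = Fin.last m
    · subst h2
      simp [h1, ha, apply_ite Neg.neg]
    · simp [h1, h2]

lemma sum_mul_ray {R : Type*} [CommRing R] (u : Edge m → R) (a b : Fin m) :
    ∑ e, u e * (ray e a b : R) = toMatrix u a.castSucc b.castSucc
      - toMatrix u a.castSucc (Fin.last m) - toMatrix u (Fin.last m) b.castSucc := by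
  simp only [ray_apply, ← sum_ite_edge, ← Finset.sum_sub_distrib]
  refine Finset.sum_congr rfl fun e _ => ?_
  push_cast
  simp only [mul_sub, mul_ite, mul_one, mul_zero]

/-- The linear relations of the configuration are the coboundaries `u_{i,j} = p_i - p_j`. -/
lemma sum_mul_ray_eq_zero_iff {R : Type*} [CommRing R] (u : Edge m → R) :
    (∀ a b, ∑ e, u e * (ray e a b : R) = 0) ↔
      ∃ p : Fin (m + 1) → R, ∀ e, u e = p e.1.1 - p e.1.2 := by
  simp only [sum_mul_ray]
  constructor
  · intro h
    refine ⟨fun i => toMatrix u i (Fin.last m), fun e => ?_⟩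
    rw [← toMatrix_edge u e]
    generalize e.1.1 = i
    generalize e.1.2 = j
    have hn : ∀ b : Fin m, toMatrix u (Fin.last m) b.castSucc
        = - toMatrix u b.castSucc (Fin.last m) := fun b => by
      have := h b b
      rw [toMatrix_self] at this
      linear_combination - this
    induction j using Fin.lastCases with
    | last => simp
    | cast b =>
      induction i using Fin.lastCases with
      | last => rw [hn]; simp
      | cast a => linear_combination h a b + hn b
  · rintro ⟨p, hp⟩ a b
    have : ∀ i j, toMatrix u i j = p i - p j := fun i j => by
      by_cases h : i = j
      · simp [h]
      · rw [toMatrix, dif_pos h, hp]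
    simp only [this]
    ring

lemma exists_sum_mul_ray {R : Type*} [CommRing R] (B : Matrix (Fin m) (Fin m) R) :
    ∃ u : Edge m → R, ∀ a b, ∑ e, u e * (ray e a b : R) = B a b := by
  -- a solution with `u_{n,j} = 0`: the diagonal entries of `B` determine `u_{i,n}`, and then the
  -- other entries determine `u_{i,j}`
  let c : Fin (m + 1) → R := fun i => Fin.lastCases 0 (fun a => - B a a) i
  let U : Fin (m + 1) → Fin (m + 1) → R := fun i j =>
    Fin.lastCases (c i) (fun b => Fin.lastCases 0 (fun a => B a b - B a a) i) j
  refine ⟨fun e => U e.1.1 e.1.2, fun a b => ?_⟩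
  have hU : ∀ i j, i ≠ j → toMatrix (fun e : Edge m => U e.1.1 e.1.2) i j = U i j :=
    fun i j h => dif_pos h
  rw [sum_mul_ray, hU _ _ (Fin.castSucc_lt_last a).ne, hU _ _ (Fin.castSucc_lt_last b).ne']
  by_cases h : a = b
  · subst h
    simp [U, c]
  · rw [hU _ _ (by simpa using h)]
    simp [U, c]

/-! ### Coordinates on the space spanned by the configuration -/

/-- The linear combination of the configuration with the given real coefficients. -/
def comb (m : ℕ) : (Edge m → ℝ) →ₗ[ℝ] W m := Fintype.linearCombination ℝ rayR

lemma comb_apply (z : Edge m → ℝ) : comb m z = ∑ e, z e • rayR e := rfl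

lemma comb_apply_apply (z : Edge m → ℝ) (a b : Fin m) :
    comb m z a b = ∑ e, z e * (ray e a b : ℝ) := by
  simp [comb_apply, Matrix.sum_apply, rayR]

lemma comb_eq_zero_iff (z : Edge m → ℝ) :
    comb m z = 0 ↔ ∃ p : Fin (m + 1) → ℝ, ∀ e, z e = p e.1.1 - p e.1.2 := by
  rw [← sum_mul_ray_eq_zero_iff, ← Matrix.ext_iff]
  simp only [comb_apply_apply, Matrix.zero_apply]

lemma comb_eq_comb_iff (z w : Edge m → ℝ) :
    comb m z = comb m w ↔ ∃ p : Fin (m + 1) → ℝ, ∀ e, z e - w e = p e.1.1 - p e.1.2 := by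
  rw [← sub_eq_zero, ← map_sub, comb_eq_zero_iff]
  rfl

lemma comb_surjective (m : ℕ) : Function.Surjective (comb m) := fun B => by
  obtain ⟨u, hu⟩ := exists_sum_mul_ray B
  exact ⟨u, Matrix.ext fun a b => (comb_apply_apply u a b).trans (hu a b)⟩

lemma comb_single (e : Edge m) : comb m (Pi.single e 1) = rayR e := by
  simp [comb]

lemma mem_coneD_iff {T : Finset (Edge m)} {y : W m} :
    y ∈ coneD T ↔ ∃ z : Edge m → ℝ, (∀ e, 0 ≤ z e) ∧ (∀ e ∈ T, z e = 0) ∧ comb m z = y := by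
  constructor
  · intro hy
    induction hy using Submodule.span_induction with
    | mem x hx =>
      obtain ⟨e, he, rfl⟩ := hx
      refine ⟨Pi.single e 1, fun f => ?_, fun f hf => ?_, comb_single e⟩
      · rw [Pi.single_apply]; split_ifs <;> simp
      · rw [Pi.single_eq_of_ne]
        rintro rfl
        exact he hf
    | zero => exact ⟨0, by simp, by simp, by simp⟩
    | add x y _ _ hx hy =>
      obtain ⟨z, h1, h2, rfl⟩ := hx
      obtain ⟨w, h3, h4, rfl⟩ := hy
      exact ⟨z + w, fun e => add_nonneg (h1 e) (h3 e), fun e he => by simp [h2 e he, h4 e he],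
        map_add _ _ _⟩
    | smul c x _ hx =>
      obtain ⟨z, h1, h2, rfl⟩ := hx
      refine ⟨(c : ℝ) • z, fun e => mul_nonneg c.2 (h1 e), fun e he => by simp [h2 e he],
        map_smul _ _ _⟩
  · rintro ⟨z, h1, h2, rfl⟩
    rw [comb_apply]
    refine Submodule.sum_mem _ fun e _ => ?_
    by_cases he : e ∈ T
    · simp [h2 e he]
    · exact Submodule.smul_mem _ (⟨z e, h1 e⟩ : {c : ℝ // 0 ≤ c})
        (Submodule.subset_span ⟨e, he, rfl⟩)

lemma hull_range_rayR : PointedCone.hull ℝ (Set.range (rayR (m := m))) = coneD ∅ := by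
  simp [coneD]

/-- Modulo linear relations, every coefficient vector vanishes on a given arborescence. -/
lemma exists_comb_eq_of_arb {ℓ : Fin (m + 1)} {T : Finset (Edge m)} (hT : IsArborescence ℓ T)
    (y : W m) : ∃ z : Edge m → ℝ, (∀ e ∈ T, z e = 0) ∧ comb m z = y := by
  obtain ⟨z, rfl⟩ := comb_surjective m y
  obtain ⟨p, hp⟩ := hT.exists_potential z
  refine ⟨fun e => z e + (p e.1.1 - p e.1.2), fun e he => ?_, ?_⟩
  · linarith [hp e he]
  · rw [comb_eq_comb_iff]
    exact ⟨p, fun e => by ring⟩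

/-- A potential that does not decrease along the edges of a spanning set is minimal at the
root. -/
lemma IsSpanning.le_of_forall_le {ℓ : Fin (m + 1)} {G : Finset (Edge m)} (hG : IsSpanning ℓ G)
    {p : Fin (m + 1) → ℝ} (hp : ∀ e ∈ G, p e.1.1 ≤ p e.1.2) (v : Fin (m + 1)) : p ℓ ≤ p v := by
  refine hG.induction (P := fun S => ∀ v ∈ S, p ℓ ≤ p v) (by simp) ?_ v (Finset.mem_univ v)
  intro S _ ih e he hc v hv
  rcases Finset.mem_insert.1 hv with rfl | hv
  · exact (ih _ (mem_cut.1 hc).1).trans (hp e he)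
  · exact ih v hv

/-- A point of the cone has at most one expression with nonnegative coefficients whose zero set is
spanning. This is why the cones of different arborescences overlap in common faces only. -/
lemma coeff_unique {ℓ : Fin (m + 1)} {T T' : Finset (Edge m)} (hT : IsSpanning ℓ T)
    (hT' : IsSpanning ℓ T') {z w : Edge m → ℝ} (hz : ∀ e, 0 ≤ z e) (hw : ∀ e, 0 ≤ w e)
    (hzT : ∀ e ∈ T, z e = 0) (hwT : ∀ e ∈ T', w e = 0) (h : comb m z = comb m w) : z = w := by
  obtain ⟨p, hp⟩ := (comb_eq_comb_iff z w).1 h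
  have h1 : ∀ v, p ℓ ≤ p v := hT.le_of_forall_le fun e he => by
    have := hp e
    rw [hzT e he] at this
    linarith [hw e]
  have h2 : ∀ v, - p ℓ ≤ - p v := hT'.le_of_forall_le (p := fun v => - p v) fun e he => by
    have := hp e
    rw [hwT e he] at this
    linarith [hz e]
  funext e
  linarith [hp e, h1 e.1.1, h1 e.1.2, h2 e.1.1, h2 e.1.2]

/-- The vectors outside a spanning edge set are linearly independent. -/
lemma eq_zero_of_comb_eq_zero {ℓ : Fin (m + 1)} {T : Finset (Edge m)} (hT : IsSpanning ℓ T)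
    {z : Edge m → ℝ} (hzT : ∀ e ∈ T, z e = 0) (h : comb m z = 0) : z = 0 := by
  obtain ⟨p, hp⟩ := (comb_eq_zero_iff z).1 h
  have h1 : ∀ v, p ℓ ≤ p v := hT.le_of_forall_le fun e he => by
    linarith [hp e, hzT e he]
  have h2 : ∀ v, - p ℓ ≤ - p v := hT.le_of_forall_le (p := fun v => - p v) fun e he => by
    linarith [hp e, hzT e he]
  funext e
  simp only [Pi.zero_apply]
  linarith [hp e, h1 e.1.1, h1 e.1.2, h2 e.1.1, h2 e.1.2]

/-! ### The triangulation -/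

lemma exists_pos_forall_le {ι : Type*} (s : Finset ι) {f : ι → ℝ} (hf : ∀ i ∈ s, 0 < f i) :
    ∃ ε > 0, ∀ i ∈ s, ε ≤ f i := by
  rcases s.eq_empty_or_nonempty with rfl | hs
  · exact ⟨1, one_pos, by simp⟩
  · obtain ⟨i, hi, hmin⟩ := s.exists_min_image f hs
    exact ⟨f i, hf i hi, hmin⟩

/-- Among the potentials `p` with `p ℓ = 0` that keep the coefficients nonnegative, one with the
largest sum makes the coefficients vanish on a spanning set: otherwise it could be increased on
the complement of a node set that no tight edge leaves. -/
lemma exists_isSpanning_zero (ℓ : Fin (m + 1)) {z : Edge m → ℝ} (hz : ∀ e, 0 ≤ z e) :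
    ∃ w : Edge m → ℝ, (∀ e, 0 ≤ w e) ∧ comb m w = comb m z ∧
      IsSpanning ℓ (Finset.univ.filter fun e => w e = 0) := by
  classical
  let K : Set (Fin (m + 1) → ℝ) := {p | p ℓ = 0 ∧ ∀ e : Edge m, 0 ≤ z e + (p e.1.1 - p e.1.2)}
  have hKc : IsClosed K := by
    have hK : K = {p | p ℓ = 0} ∩ ⋂ e : Edge m, {p | 0 ≤ z e + (p e.1.1 - p e.1.2)} := by
      ext p
      simp [K]
    rw [hK]
    exact (isClosed_eq (by fun_prop) (by fun_prop)).inter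
      (isClosed_iInter fun e => isClosed_le (by fun_prop) (by fun_prop))
  have hKb : K ⊆ Set.Icc (fun v => - toMatrix z v ℓ) (fun v => toMatrix z ℓ v) := by
    rintro p ⟨h0, hp⟩
    refine ⟨fun v => ?_, fun v => ?_⟩
    · by_cases hv : v = ℓ
      · subst hv; simp [h0]
      · have := hp ⟨(v, ℓ), hv⟩
        simp only [toMatrix, ne_eq, hv, not_false_eq_true, dif_pos]
        linarith
    · by_cases hv : ℓ = v
      · subst hv; simp [h0]
      · have := hp ⟨(ℓ, v), hv⟩
        simp only [toMatrix, ne_eq, hv, not_false_eq_true, dif_pos]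
        linarith
  obtain ⟨p, ⟨h0, hp⟩, hmax⟩ := (isCompact_Icc.of_isClosed_subset hKc hKb).exists_isMaxOn
    ⟨0, rfl, fun e => by simpa using hz e⟩
    (f := fun p : Fin (m + 1) → ℝ => ∑ v, p v) (by fun_prop)
  refine ⟨fun e => z e + (p e.1.1 - p e.1.2), hp,
    (comb_eq_comb_iff _ _).2 ⟨p, fun e => by ring⟩, fun S hS hne => ?_⟩
  by_contra! hcon
  obtain ⟨ε, hε, hεle⟩ := exists_pos_forall_le (cut S)
    (f := fun e => z e + (p e.1.1 - p e.1.2)) fun e he => (hp e).lt_of_ne fun h =>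
      hcon e (by simpa using h.symm) he
  obtain ⟨v, hv⟩ : ∃ v, v ∉ S := by
    by_contra! h
    exact hne (Finset.eq_univ_of_forall h)
  have hmem : (fun v => if v ∈ S then p v else p v + ε) ∈ K := by
    refine ⟨by simp [hS, h0], fun e => ?_⟩
    dsimp only
    have h1 := hp e
    by_cases ha : e.1.1 ∈ S <;> by_cases hb : e.1.2 ∈ S
    · simpa [ha, hb] using h1
    · have := hεle e (mem_cut.2 ⟨ha, hb⟩)
      simp only [ha, hb, if_true, if_false]
      linarith
    · simp only [ha, hb, if_true, if_false]
      linarith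
    · simp only [ha, hb, if_false]
      linarith
  refine absurd (isMaxOn_iff.1 hmax _ hmem)
    (not_le.2 (Finset.sum_lt_sum (fun u _ => ?_) ⟨v, Finset.mem_univ v, ?_⟩))
  · split_ifs <;> linarith
  · simp [hv, hε]

/-- The cones of the arborescences cover the cone of the whole configuration. -/
lemma mem_coneD_empty_iff (ℓ : Fin (m + 1)) {y : W m} :
    y ∈ coneD (∅ : Finset (Edge m)) ↔ ∃ T ∈ Arb ℓ, y ∈ coneD T := by
  simp only [mem_coneD_iff]
  constructor
  · rintro ⟨z, hz, -, rfl⟩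
    obtain ⟨w, hw, heq, hs⟩ := exists_isSpanning_zero ℓ hz
    obtain ⟨T, hT, hsub⟩ := hs.exists_arborescence
    exact ⟨T, hT, w, hw, fun e he => by simpa using hsub he, heq⟩
  · rintro ⟨T, -, z, hz, -, rfl⟩
    exact ⟨z, hz, by simp, rfl⟩

lemma coneD_injOn (ℓ : Fin (m + 1)) : Set.InjOn (coneD (m := m)) (Arb ℓ) := by
  classical
  intro T hT T' hT' h
  -- the sum of the generators of one cone lies in the other cone
  have hmem : comb m (fun e => if e ∈ T then 0 else 1) ∈ coneD T' := by
    rw [← h, mem_coneD_iff]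
    exact ⟨_, fun e => by positivity, fun e he => by simp [he], rfl⟩
  obtain ⟨w, hw, hwT, heq⟩ := mem_coneD_iff.1 hmem
  have huniq := coeff_unique (IsArborescence.isSpanning hT) (IsArborescence.isSpanning hT')
    (fun e => by positivity) hw (fun e he => by simp [he]) hwT heq.symm
  refine (IsArborescence.eq_of_subset hT' hT fun e he => ?_).symm
  by_contra hn
  have := congrFun huniq e
  simp [hn, hwT e he] at this

lemma linearIndependent_rayR {ℓ : Fin (m + 1)} {T : Finset (Edge m)} (hT : IsArborescence ℓ T) :
    LinearIndependent ℝ (fun e : {e : Edge m // e ∉ T} => rayR e.1) := by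
  classical
  rw [Fintype.linearIndependent_iff]
  intro g hg e
  have hz : comb m (fun e => if h : e ∉ T then g ⟨e, h⟩ else 0) = 0 := by
    rw [← hg, comb_apply]
    refine (Fintype.sum_of_injective Subtype.val Subtype.val_injective _ _ (fun e he => ?_)
      fun e => by rw [dif_pos e.2]).symm
    rw [dif_neg fun h => he ⟨⟨e, h⟩, rfl⟩, zero_smul]
  have := congrFun (eq_zero_of_comb_eq_zero hT.isSpanning
    (fun e he => dif_neg (not_not.2 he)) hz) e
  simpa [e.2] using this

lemma coneD_isSimplicial {ℓ : Fin (m + 1)} {T : Finset (Edge m)} (hT : IsArborescence ℓ T) :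
    (coneD T).IsSimplicial := by
  refine ⟨rayR '' {e | e ∉ T}, Set.toFinite _, ?_, rfl⟩
  rw [Set.image_eq_range]
  exact (linearIndependent_rayR hT).linearIndepOn_id

lemma span_coneD {ℓ : Fin (m + 1)} {T : Finset (Edge m)} (hT : IsArborescence ℓ T) :
    Submodule.span ℝ (coneD T : Set (W m)) = ⊤ := by
  rw [eq_top_iff]
  rintro y -
  obtain ⟨z, hz, rfl⟩ := exists_comb_eq_of_arb hT y
  rw [comb_apply]
  refine Submodule.sum_mem _ fun e _ => ?_
  by_cases he : e ∈ T
  · simp [hz e he]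
  · exact Submodule.smul_mem _ _ (Submodule.subset_span (Submodule.subset_span ⟨e, he, rfl⟩))

lemma coneD_isUnimodular {ℓ : Fin (m + 1)} {T : Finset (Edge m)} (hT : IsArborescence ℓ T) :
    IsUnimodular (coneD T) := by
  classical
  let φ := (Fintype.equivFin {e : Edge m // e ∉ T}).symm
  have hrange : Set.range (fun i => rayR (φ i).1) = rayR '' {e | e ∉ T} := by
    rw [Set.image_eq_range]
    exact φ.surjective.range_comp fun e : {e : Edge m // e ∉ T} => rayR e.1
  refine ⟨_, fun i => rayR (φ i).1, (linearIndependent_rayR hT).comp φ φ.injective, ?_, ?_⟩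
  · rw [hrange]; rfl
  · rw [hrange, span_coneD hT]
    simp only [Submodule.mem_top, true_and]
    ext A
    constructor
    · intro hA
      induction hA using Submodule.span_induction with
      | mem x hx =>
        obtain ⟨e, -, rfl⟩ := hx
        exact ⟨ray e, rfl⟩
      | zero => exact ⟨0, by ext; simp⟩
      | add x y _ _ hx hy =>
        obtain ⟨B, rfl⟩ := hx
        obtain ⟨C, rfl⟩ := hy
        exact ⟨B + C, by ext; simp⟩
      | smul c x _ hx =>
        obtain ⟨B, rfl⟩ := hx
        exact ⟨c • B, by
          ext a b
          rw [Matrix.map_apply, Matrix.smul_apply, Matrix.smul_apply, Matrix.map_apply,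
            zsmul_eq_mul, smul_eq_mul, Int.cast_mul]⟩
    · rintro ⟨B, rfl⟩
      obtain ⟨u, hu⟩ := exists_sum_mul_ray B
      obtain ⟨p, hp⟩ := hT.exists_potential u
      have h0 : ∀ e ∈ T, u e + (p e.1.1 - p e.1.2) = 0 := fun e he => by rw [hp e he]; ring
      have hB : B.map (fun z : ℤ => (z : ℝ)) = ∑ e, (u e + (p e.1.1 - p e.1.2)) • rayR e := by
        ext a b
        have h1 := (sum_mul_ray_eq_zero_iff fun e : Edge m => p e.1.1 - p e.1.2).2
          ⟨p, fun e => rfl⟩ a b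
        simp only [Int.cast_id] at h1 hu
        have h2 : B a b = ∑ e, (u e + (p e.1.1 - p e.1.2)) * ray e a b := by
          simp only [add_mul, Finset.sum_add_distrib, hu, h1, add_zero]
        rw [Matrix.map_apply, h2, Matrix.sum_apply]
        push_cast
        refine Finset.sum_congr rfl fun e _ => ?_
        rw [Matrix.smul_apply, rayR, Matrix.map_apply, zsmul_eq_mul]
        push_cast
        rfl
      rw [SetLike.mem_coe, hB]
      refine Submodule.sum_mem _ fun e _ => ?_
      by_cases he : e ∈ T
      · simp [h0 e he]
      · exact Submodule.smul_mem _ _ (Submodule.subset_span ⟨e, he, rfl⟩)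

lemma coneD_inf_isFaceOf {ℓ : Fin (m + 1)} {T T' : Finset (Edge m)} (hT : IsArborescence ℓ T)
    (hT' : IsArborescence ℓ T') : (coneD T ⊓ coneD T').IsFaceOf (coneD T) where
  le := inf_le_left
  mem_of_smul_add_mem := by
    intro x y a hx hy ha hxy
    refine ⟨hx, ?_⟩
    obtain ⟨z, hz, hzT, rfl⟩ := mem_coneD_iff.1 hx
    obtain ⟨w, hw, hwT, rfl⟩ := mem_coneD_iff.1 hy
    obtain ⟨v, hv, hvT, heq⟩ := mem_coneD_iff.1 hxy.2
    rw [← map_smul, ← map_add] at heq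
    have huniq := coeff_unique hT'.isSpanning hT.isSpanning hv
      (fun e => add_nonneg (mul_nonneg ha.le (hz e)) (hw e)) hvT
      (fun e he => by simp [hzT e he, hwT e he]) heq
    refine mem_coneD_iff.2 ⟨z, hz, fun e he => ?_, rfl⟩
    have h1 := congrFun huniq e
    rw [hvT e he] at h1
    change 0 = a * z e + w e at h1
    have h2 : a * z e = 0 := by linarith [mul_nonneg ha.le (hz e), hw e]
    exact (mul_eq_zero.1 h2).resolve_left ha.ne'

/-- Points of the relative interior have positive coefficients on all generators. -/
lemma pos_of_mem_intrinsicInterior {ℓ : Fin (m + 1)} {T : Finset (Edge m)}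
    (hT : IsArborescence ℓ T) {z : Edge m → ℝ} (hz : ∀ e ∈ T, z e = 0)
    (h : comb m z ∈ intrinsicInterior ℝ (coneD T : Set (W m))) {e : Edge m} (he : e ∉ T) :
    0 < z e := by
  classical
  have haff : affineSpan ℝ (coneD T : Set (W m)) = ⊤ := by
    rw [AffineSubspace.affineSpan_eq_top_iff_vectorSpan_eq_top_of_nonempty ℝ _ _
      ⟨0, (coneD T).zero_mem⟩, vectorSpan_eq_span_vsub_set_right ℝ (coneD T).zero_mem]
    simpa using span_coneD hT
  obtain ⟨y, hy, hyz⟩ := h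
  -- moving a little against the generator `e` stays in the cone
  let c : ℝ → affineSpan ℝ (coneD T : Set (W m)) := fun ε =>
    ⟨comb m z - ε • rayR e, haff ▸ AffineSubspace.mem_top ℝ (W m) _⟩
  have hc : Continuous c := Continuous.subtype_mk (by fun_prop) _
  have hc0 : c 0 = y := Subtype.ext (by simp [c, hyz])
  have hnhds : ∀ᶠ ε in 𝓝 (0 : ℝ), c ε ∈ interior ((↑) ⁻¹' (coneD T : Set (W m))) :=
    hc.tendsto 0 (isOpen_interior.mem_nhds (hc0 ▸ hy))
  obtain ⟨ε, hε, hε0⟩ := ((hnhds.filter_mono nhdsWithin_le_nhds).and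
    (self_mem_nhdsWithin (s := Set.Ioi (0 : ℝ)))).exists
  have hmem : c ε ∈ (↑) ⁻¹' (coneD T : Set (W m)) := interior_subset hε
  obtain ⟨w, hw, hwT, heq⟩ := mem_coneD_iff.1 hmem
  have h0 := eq_zero_of_comb_eq_zero hT.isSpanning (z := w - (z - ε • Pi.single e 1))
    (fun f hf => by
      have : f ≠ e := fun h => he (h ▸ hf)
      simp [hwT f hf, hz f hf, this]) (by
      rw [map_sub, map_sub, map_smul, comb_single, heq, sub_self])
  have h1 := congrFun h0 e
  simp only [Pi.sub_apply, Pi.smul_apply, Pi.single_eq_same, smul_eq_mul, Pi.zero_apply] at h1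
  have : 0 < ε := hε0
  linarith [hw e]

lemma coneD_isTriangulation (ℓ : Fin (m + 1)) :
    IsTriangulation (coneD (∅ : Finset (Edge m))) (coneD '' Arb ℓ) where
  finite := Set.toFinite _
  simplicial := by
    rintro _ ⟨T, hT, rfl⟩
    exact coneD_isSimplicial hT
  full_dim := by
    rintro _ ⟨T, hT, rfl⟩
    rw [span_coneD hT, eq_comm, eq_top_iff, ← span_coneD hT]
    exact Submodule.span_mono fun y hy => (mem_coneD_empty_iff ℓ).2 ⟨T, hT, hy⟩
  cover := by
    ext y
    simp [mem_coneD_empty_iff ℓ]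
  inter_face := by
    rintro _ ⟨T, hT, rfl⟩ _ ⟨T', hT', rfl⟩
    exact coneD_inf_isFaceOf hT hT'
  disjoint_interior := by
    rintro _ ⟨T, hT, rfl⟩ _ ⟨T', hT', rfl⟩ hne
    rw [Set.disjoint_left]
    intro y hy hy'
    obtain ⟨z, hz, hzT, rfl⟩ := mem_coneD_iff.1 (intrinsicInterior_subset hy)
    obtain ⟨w, hw, hwT, heq⟩ := mem_coneD_iff.1 (intrinsicInterior_subset hy')
    obtain rfl := coeff_unique (IsArborescence.isSpanning hT) (IsArborescence.isSpanning hT')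
      hz hw hzT hwT heq.symm
    refine hne (congrArg coneD (IsArborescence.eq_of_subset hT hT' fun e he => ?_))
    by_contra hn
    exact (pos_of_mem_intrinsicInterior hT' hwT hy' hn).ne' (hzT e he)

/-! ### Duality with the supporting cone -/

lemma dot_apply (A B : W m) : dot m A B = ∑ a, ∑ b, A a b * B a b := rfl

/-- For a matrix with zero row and column sums, pairing its truncation with the configuration
recovers the entries off the diagonal. -/
lemma dot_proj_rayR {u : Matrix (Fin (m + 1)) (Fin (m + 1)) ℝ} (hrow : ∀ i, ∑ j, u i j = 0)
    (hcol : ∀ j, ∑ i, u i j = 0) (e : Edge m) : dot m (proj m u) (rayR e) = u e.1.1 e.1.2 := by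
  obtain ⟨⟨i, j⟩, hij⟩ := e
  have h1 : ∀ i, ∑ b : Fin m, u i b.castSucc = - u i (Fin.last m) := fun i => by
    have := hrow i
    rw [Fin.sum_univ_castSucc] at this
    linarith
  have h2 : ∀ j, ∑ a : Fin m, u a.castSucc j = - u (Fin.last m) j := fun j => by
    have := hcol j
    rw [Fin.sum_univ_castSucc] at this
    linarith
  have hl : ∀ a : Fin m, Fin.last m ≠ a.castSucc := fun a => (Fin.castSucc_lt_last a).ne'
  simp only [dot_apply, proj, Matrix.submatrix_apply, rayR, Matrix.map_apply, ray_apply,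
    Prod.mk.injEq]
  dsimp only at hij
  induction j using Fin.lastCases with
  | last =>
    induction i using Fin.lastCases with
    | last => exact absurd rfl hij
    | cast a =>
      simp [hl, (hl _).symm, Finset.sum_ite_eq, h1]
  | cast b =>
    induction i using Fin.lastCases with
    | last => simp [hl, (hl _).symm, Finset.sum_ite_eq, h2]
    | cast a => simp [(hl _).symm, Finset.sum_ite_eq, ite_and]

lemma exists_proj_eq (A : W m) : ∃ u : Matrix (Fin (m + 1)) (Fin (m + 1)) ℝ,
    (∀ i, ∑ j, u i j = 0) ∧ (∀ j, ∑ i, u i j = 0) ∧ proj m u = A := by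
  let u : Matrix (Fin (m + 1)) (Fin (m + 1)) ℝ := fun i j =>
    Fin.lastCases (Fin.lastCases (∑ a, ∑ b, A a b) (fun b => - ∑ a, A a b) j)
      (fun a => Fin.lastCases (- ∑ b, A a b) (fun b => A a b) j) i
  refine ⟨u, fun i => ?_, fun j => ?_, ?_⟩
  · rw [Fin.sum_univ_castSucc]
    induction i using Fin.lastCases with
    | last => simp [u, Finset.sum_comm (f := fun a b => A a b)]
    | cast a => simp [u]
  · rw [Fin.sum_univ_castSucc]
    induction j using Fin.lastCases with
    | last => simp [u]
    | cast b => simp [u]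
  · ext a b
    change u a.castSucc b.castSucc = A a b
    simp [u]

lemma mem_supportingCone_iff {u : Matrix (Fin (m + 1)) (Fin (m + 1)) ℝ} :
    u ∈ supportingCone
        (doublyStochastic ℝ (Fin (m + 1)) : Set (Matrix (Fin (m + 1)) (Fin (m + 1)) ℝ)) 1 ↔
      (∀ i, ∑ j, u i j = 0) ∧ (∀ j, ∑ i, u i j = 0) ∧ ∀ i j, i ≠ j → 0 ≤ u i j := by
  have hmem : ∀ δ : ℝ, 1 + δ • u ∈ doublyStochastic ℝ (Fin (m + 1)) ↔
      (∀ i j, 0 ≤ (1 : Matrix (Fin (m + 1)) (Fin (m + 1)) ℝ) i j + δ * u i j) ∧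
      (∀ i, δ * ∑ j, u i j = 0) ∧ ∀ j, δ * ∑ i, u i j = 0 := fun δ => by
    rw [mem_doublyStochastic_iff_sum]
    simp [Finset.sum_add_distrib, Finset.mul_sum, Matrix.one_apply]
  constructor
  · intro h
    have h : ∀ᶠ δ : ℝ in 𝓝[>] 0, 1 + δ • u ∈ doublyStochastic ℝ (Fin (m + 1)) := h
    obtain ⟨δ, hδ, hpos⟩ := (Filter.Eventually.and h
      (self_mem_nhdsWithin (s := Set.Ioi (0 : ℝ)))).exists
    have hpos : 0 < δ := hpos
    obtain ⟨h0, hr, hc⟩ := (hmem δ).1 hδ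
    refine ⟨fun i => (mul_eq_zero.1 (hr i)).resolve_left hpos.ne',
      fun j => (mul_eq_zero.1 (hc j)).resolve_left hpos.ne', fun i j hij => ?_⟩
    have := h0 i j
    rw [Matrix.one_apply_ne hij, zero_add] at this
    exact nonneg_of_mul_nonneg_right this hpos
  · rintro ⟨hr, hc, h0⟩
    have hdiag : ∀ᶠ δ : ℝ in 𝓝[>] 0, ∀ i, 0 ≤ 1 + δ * u i i := by
      refine Filter.eventually_all.2 fun i => ?_
      have hcont : Continuous fun δ : ℝ => 1 + δ * u i i := by fun_prop
      have := (hcont.tendsto 0).eventually (lt_mem_nhds (a := 0) (by simp))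
      exact (this.filter_mono nhdsWithin_le_nhds).mono fun δ h => h.le
    change ∀ᶠ δ : ℝ in 𝓝[>] 0, 1 + δ • u ∈ doublyStochastic ℝ (Fin (m + 1))
    filter_upwards [hdiag, self_mem_nhdsWithin] with δ hδ hpos
    have hpos : 0 < δ := hpos
    refine (hmem δ).2 ⟨fun i j => ?_, fun i => by rw [hr, mul_zero], fun j => by rw [hc, mul_zero]⟩
    by_cases hij : i = j
    · subst hij
      simpa using hδ i
    · rw [Matrix.one_apply_ne hij, zero_add]
      exact mul_nonneg hpos.le (h0 i j hij)

/-- The projected supporting cone is cut out by the configuration. -/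
lemma mem_projectedCone_iff {A : W m} :
    A ∈ projectedCone m ↔ ∀ e : Edge m, 0 ≤ dot m A (rayR e) := by
  constructor
  · rintro ⟨u, hu, rfl⟩ e
    obtain ⟨hr, hc, h0⟩ := mem_supportingCone_iff.1 hu
    rw [dot_proj_rayR hr hc]
    exact h0 _ _ e.2
  · intro h
    obtain ⟨u, hr, hc, rfl⟩ := exists_proj_eq A
    refine ⟨u, mem_supportingCone_iff.2 ⟨hr, hc, fun i j hij => ?_⟩, rfl⟩
    have := h ⟨(i, j), hij⟩
    rwa [dot_proj_rayR hr hc] at this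

/-- A simplicial cone is closed, as the image of an orthant under an injective linear map. -/
lemma isClosed_coneD_of_arb {ℓ : Fin (m + 1)} {T : Finset (Edge m)} (hT : IsArborescence ℓ T) :
    IsClosed (coneD T : Set (W m)) := by
  let V : Submodule ℝ (Edge m → ℝ) :=
    { carrier := {z | ∀ e ∈ T, z e = 0}
      add_mem' := fun ha hb e he => by simp [ha e he, hb e he]
      zero_mem' := fun _ _ => rfl
      smul_mem' := fun c z hz e he => by simp [hz e he] }
  -- the coefficient vectors supported outside `T` are coordinates on the ambient space
  have hinj : LinearMap.ker ((comb m).domRestrict V) = ⊥ := by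
    rw [LinearMap.ker_eq_bot']
    rintro ⟨z, hz⟩ h
    exact Subtype.ext (eq_zero_of_comb_eq_zero hT.isSpanning hz h)
  have himage : (coneD T : Set (W m)) =
      (comb m).domRestrict V '' ⋂ e : Edge m, {z : V | 0 ≤ z.1 e} := by
    ext y
    rw [SetLike.mem_coe, mem_coneD_iff]
    constructor
    · rintro ⟨z, hz, hzT, rfl⟩
      exact ⟨⟨z, hzT⟩, Set.mem_iInter.2 hz, rfl⟩
    · rintro ⟨z, hz, rfl⟩
      exact ⟨z.1, fun e => Set.mem_iInter.1 hz e, z.2, rfl⟩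
  rw [himage]
  refine (LinearMap.isClosedEmbedding_of_injective hinj).isClosedMap _
    (isClosed_iInter fun e => isClosed_le continuous_const ?_)
  exact (continuous_apply e).comp continuous_subtype_val

lemma isClosed_coneD_empty : IsClosed (coneD (∅ : Finset (Edge m)) : Set (W m)) := by
  have : (coneD (∅ : Finset (Edge m)) : Set (W m)) = ⋃ T ∈ Arb (Fin.last m), coneD T := by
    ext y
    simp [mem_coneD_empty_iff (Fin.last m)]
  rw [this]
  exact (Set.toFinite _).isClosed_biUnion fun T hT => isClosed_coneD_of_arb hT

/-- The bipolar theorem for the closed cone of the configuration, whose dual is the projected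
supporting cone. -/
lemma dualCone_eq (m : ℕ) : dualCone m = coneD (∅ : Finset (Edge m)) := by
  refine le_antisymm (fun y hy => ?_) (Submodule.span_le.2 ?_)
  · by_contra hn
    have : LocallyConvexSpace ℝ (W m) :=
      inferInstanceAs (LocallyConvexSpace ℝ (Fin m → Fin m → ℝ))
    obtain ⟨f, hf, hfy⟩ := ProperCone.hyperplane_separation_point
      (C := (⟨coneD (∅ : Finset (Edge m)), isClosed_coneD_empty⟩ : ProperCone ℝ (W m))) hn
    have hdot : ∀ x : W m, dot m (fun a b => f (Matrix.single a b 1)) x = f x := fun x => by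
      have hsingle : ∀ a b, Matrix.single a b (x a b) = x a b • Matrix.single a b (1 : ℝ) :=
        fun a b => by rw [Matrix.smul_single, smul_eq_mul, mul_one]
      change ∑ a, ∑ b, f (Matrix.single a b 1) * x a b = f x
      conv_rhs => rw [Matrix.matrix_eq_sum_single x]
      simp only [map_sum, hsingle, map_smul, smul_eq_mul]
      exact Finset.sum_congr rfl fun a _ => Finset.sum_congr rfl fun b _ => mul_comm _ _
    refine absurd (hy (mem_projectedCone_iff.2 fun e => ?_)) (not_le.2 (hdot y ▸ hfy))
    rw [hdot]
    exact hf _ (Submodule.subset_span ⟨e, by simp, rfl⟩)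
  · rintro _ ⟨e, -, rfl⟩ A hA
    exact mem_projectedCone_iff.1 hA e

/-! ### Flows and the regular subdivision -/

/-- Inflow minus outflow at a node. -/
def excess (z : Edge m → ℝ) (v : Fin (m + 1)) : ℝ :=
  ∑ e, z e * ((if e.1.2 = v then 1 else 0) - (if e.1.1 = v then 1 else 0))

lemma excess_add (z w : Edge m → ℝ) (v : Fin (m + 1)) :
    excess (z + w) v = excess z v + excess w v := by
  simp [excess, add_mul, Finset.sum_add_distrib]

lemma excess_smul (c : ℝ) (z : Edge m → ℝ) (v : Fin (m + 1)) :
    excess (c • z) v = c * excess z v := by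
  simp [excess, Finset.mul_sum, mul_assoc]

lemma excess_sub (z w : Edge m → ℝ) (v : Fin (m + 1)) :
    excess (z - w) v = excess z v - excess w v := by
  simp [excess, sub_mul, Finset.sum_sub_distrib]

lemma excess_sum {ι : Type*} (s : Finset ι) (z : ι → Edge m → ℝ) (v : Fin (m + 1)) :
    excess (∑ i ∈ s, z i) v = ∑ i ∈ s, excess (z i) v := by
  simp only [excess, Finset.sum_apply, Finset.sum_mul]
  exact Finset.sum_comm

lemma excess_single (e : Edge m) (v : Fin (m + 1)) :
    excess (Pi.single e 1) v = (if e.1.2 = v then 1 else 0) - (if e.1.1 = v then 1 else 0) := by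
  rw [excess, Finset.sum_eq_single e]
  · simp
  · intro f _ hf
    simp [hf]
  · simp

lemma sum_excess (z : Edge m → ℝ) : ∑ v, excess z v = 0 := by
  simp only [excess]
  rw [Finset.sum_comm]
  simp [← Finset.mul_sum, Finset.sum_sub_distrib]

lemma sum_cut_sub_sum_cut_compl (z : Edge m → ℝ) (S : Finset (Fin (m + 1))) :
    ∑ e ∈ cut S, z e - ∑ e ∈ cut Sᶜ, z e =
      ∑ e, z e * ((if e.1.1 ∈ S then 1 else 0) - (if e.1.2 ∈ S then 1 else 0)) := by
  rw [cut, cut, Finset.sum_filter, Finset.sum_filter, ← Finset.sum_sub_distrib]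
  refine Finset.sum_congr rfl fun e _ => ?_
  by_cases h1 : e.1.1 ∈ S <;> by_cases h2 : e.1.2 ∈ S <;> simp [h1, h2]

lemma excess_eq_cut (z : Edge m → ℝ) (v : Fin (m + 1)) :
    excess z v = ∑ e ∈ cut ({v}ᶜ : Finset (Fin (m + 1))), z e - ∑ e ∈ cut {v}, z e := by
  have := sum_cut_sub_sum_cut_compl z {v}
  simp only [Finset.mem_singleton] at this
  rw [← neg_sub, this, excess, ← Finset.sum_neg_distrib]
  exact Finset.sum_congr rfl fun e _ => by ring

lemma sum_mul_dot_rayR (c : W m) (q : Edge m → ℝ) :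
    ∑ e, dot m c (rayR e) * q e = dot m c (comb m q) := by
  simp [comb_apply, mul_comm]

/-- Restrictions of affine functions to the configuration are balanced across every cut. -/
lemma sum_cut_affine (c : W m) (c₀ : ℝ) (S : Finset (Fin (m + 1))) :
    ∑ e ∈ cut S, (dot m c (rayR e) - c₀) = ∑ e ∈ cut Sᶜ, (dot m c (rayR e) - c₀) := by
  rw [← sub_eq_zero, sum_cut_sub_sum_cut_compl]
  simp only [sub_mul _ c₀, Finset.sum_sub_distrib, sum_mul_dot_rayR, ← Finset.mul_sum]
  rw [(comb_eq_zero_iff _).2 ⟨fun v => if v ∈ S then 1 else 0, fun e => rfl⟩, map_zero]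
  let swap : Edge m ≃ Edge m :=
    { toFun := fun e => ⟨(e.1.2, e.1.1), e.2.symm⟩
      invFun := fun e => ⟨(e.1.2, e.1.1), e.2.symm⟩
      left_inv := fun e => rfl
      right_inv := fun e => rfl }
  have : ∑ e : Edge m, (if e.1.1 ∈ S then (1 : ℝ) else 0) =
      ∑ e : Edge m, (if e.1.2 ∈ S then 1 else 0) :=
    swap.sum_comp fun e : Edge m => if e.1.2 ∈ S then (1 : ℝ) else 0
  rw [this]
  ring

/-- Circulations are restrictions of linear functions to the configuration. -/
lemma exists_dot_rayR_eq {f : Edge m → ℝ} (hf : ∀ v, excess f v = 0) :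
    ∃ c : W m, ∀ e, dot m c (rayR e) = f e := by
  let d : Fin (m + 1) → ℝ := fun i => ∑ j, toMatrix f i j
  have hrow : ∀ v, ∑ j, toMatrix f v j = ∑ e : Edge m, f e * (if e.1.1 = v then 1 else 0) := by
    intro v
    simp only [← sum_ite_edge]
    rw [Finset.sum_comm]
    refine Finset.sum_congr rfl fun e _ => ?_
    by_cases h : e.1.1 = v <;> simp [Prod.ext_iff, h]
  have hcol : ∀ v, ∑ i, toMatrix f i v = ∑ e : Edge m, f e * (if e.1.2 = v then 1 else 0) := by
    intro v
    simp only [← sum_ite_edge]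
    rw [Finset.sum_comm]
    refine Finset.sum_congr rfl fun e _ => ?_
    by_cases h : e.1.2 = v <;> simp [Prod.ext_iff, h]
  have hbal : ∀ v, ∑ i, toMatrix f i v = d v := fun v => by
    have := hf v
    simp only [excess, mul_sub, Finset.sum_sub_distrib] at this
    simp only [d]
    rw [hrow, hcol]
    linarith
  -- the diagonal is chosen to make the row sums vanish, and then so do the column sums
  let u : Matrix (Fin (m + 1)) (Fin (m + 1)) ℝ := fun i j =>
    toMatrix f i j - if i = j then d i else 0
  refine ⟨proj m u, fun e => ?_⟩
  rw [dot_proj_rayR (fun i => ?_) (fun j => ?_)]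
  · simp [u, toMatrix_edge, e.2]
  · simp [u, Finset.sum_sub_distrib, d]
  · simp [u, Finset.sum_sub_distrib, hbal]

/-- The unit flow from the root to `v` along the edges of an arborescence. -/
lemma IsArborescence.exists_unit_flow {ℓ : Fin (m + 1)} {T : Finset (Edge m)}
    (hT : IsArborescence ℓ T) (v : Fin (m + 1)) :
    ∃ q : Edge m → ℝ, (∀ e, 0 ≤ q e) ∧ (∀ e ∉ T, q e = 0) ∧
      (∀ u, excess q u = (if v = u then 1 else 0) - (if ℓ = u then 1 else 0)) ∧
      ∀ e ∈ T, e.1.2 = v → 0 < q e := by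
  classical
  induction hT.reach v with
  | refl =>
    exact ⟨0, by simp, by simp, by simp [excess], fun e he h => absurd h (hT.root e he)⟩
  | @tail b c _ h ih =>
    obtain ⟨e, he, heq⟩ := h
    obtain ⟨rfl, rfl⟩ : e.1.1 = b ∧ e.1.2 = c := by simp [heq]
    obtain ⟨q, hq, hqT, hex, -⟩ := ih
    have hs : ∀ f, (0 : ℝ) ≤ (Pi.single e 1 : Edge m → ℝ) f := fun f => by
      rw [Pi.single_apply]; split_ifs <;> simp
    refine ⟨q + Pi.single e 1, fun f => add_nonneg (hq f) (hs f), fun f hf => ?_, fun u => ?_,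
      fun f hf hfe => ?_⟩
    · have : f ≠ e := fun h => hf (h ▸ he)
      simp [hqT f hf, this]
    · rw [excess_add, excess_single, hex]
      ring
    · obtain rfl : f = e := (hT.parent e.1.2 (hT.root e he)).unique ⟨hf, hfe⟩ ⟨he, rfl⟩
      simpa using add_pos_of_nonneg_of_pos (hq f) one_pos

/-- Every edge set containing an arborescence is the support of a nonnegative flow with prescribed
positive excesses away from the root: put a small constant on the other edges, and route the
remaining demand along the arborescence. -/
lemma IsArborescence.exists_flow {ℓ : Fin (m + 1)} {T G : Finset (Edge m)}
    (hT : IsArborescence ℓ T) (hTG : T ⊆ G) {b : Fin (m + 1) → ℝ} (hb : ∀ v, v ≠ ℓ → 0 < b v) :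
    ∃ z : Edge m → ℝ, (∀ e, 0 ≤ z e) ∧ (∀ e, z e = 0 ↔ e ∉ G) ∧
      ∀ v, v ≠ ℓ → excess z v = b v := by
  classical
  choose q hq hqT hex hpos using hT.exists_unit_flow
  let z₀ : Edge m → ℝ := fun e => if e ∈ G \ T then 1 else 0
  obtain ⟨ε, hε, hε0⟩ : ∃ ε : ℝ, (∀ v, v ≠ ℓ → 0 < b v - ε * excess z₀ v) ∧ 0 < ε := by
    have : ∀ᶠ ε : ℝ in 𝓝[>] 0, ∀ v, v ≠ ℓ → 0 < b v - ε * excess z₀ v := by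
      refine Filter.eventually_all.2 fun v => Filter.eventually_all.2 fun hv => ?_
      have hcont : Continuous fun ε : ℝ => b v - ε * excess z₀ v := by fun_prop
      exact ((hcont.tendsto 0).eventually (lt_mem_nhds (by simpa using hb v hv))).filter_mono
        nhdsWithin_le_nhds
    exact (this.and (self_mem_nhdsWithin (s := Set.Ioi (0 : ℝ)))).exists
  let s : Finset (Fin (m + 1)) := Finset.univ.erase ℓ
  let z : Edge m → ℝ := ε • z₀ + ∑ v ∈ s, (b v - ε * excess z₀ v) • q v
  have hz : ∀ e, z e = ε * z₀ e + ∑ v ∈ s, (b v - ε * excess z₀ v) * q v e := fun e => by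
    simp [z, Finset.sum_apply]
  have h0 : ∀ e, 0 ≤ z₀ e := fun e => by simp only [z₀]; split_ifs <;> simp
  have hterm : ∀ e, ∀ v ∈ s, 0 ≤ (b v - ε * excess z₀ v) * q v e := fun e v hv =>
    mul_nonneg (hε v (Finset.ne_of_mem_erase hv)).le (hq v e)
  have hsum : ∀ e, 0 ≤ ∑ v ∈ s, (b v - ε * excess z₀ v) * q v e := fun e =>
    Finset.sum_nonneg (hterm e)
  refine ⟨z, fun e => ?_, fun e => ?_, fun u hu => ?_⟩
  · rw [hz]
    exact add_nonneg (mul_nonneg hε0.le (h0 e)) (hsum e)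
  · constructor
    · intro h he
      rw [hz] at h
      by_cases heT : e ∈ T
      · have hv : e.1.2 ∈ s := Finset.mem_erase.2 ⟨hT.root e heT, Finset.mem_univ _⟩
        have h1 : 0 < (b e.1.2 - ε * excess z₀ e.1.2) * q e.1.2 e :=
          mul_pos (hε _ (hT.root e heT)) (hpos _ e heT rfl)
        have h2 := Finset.single_le_sum (hterm e) hv
        linarith [mul_nonneg hε0.le (h0 e)]
      · have h1 : z₀ e = 1 := by simp [z₀, he, heT]
        rw [h1] at h
        linarith [hsum e]
    · intro he
      have heT : e ∉ T := fun h => he (hTG h)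
      rw [hz, Finset.sum_eq_zero fun v _ => by rw [hqT v e heT, mul_zero]]
      simp [z₀, he]
  · have hsu : u ∈ s := Finset.mem_erase.2 ⟨hu, Finset.mem_univ _⟩
    simp only [z, excess_add, excess_smul, excess_sum, hex]
    simp [hsu, hu.symm]

lemma regularCells_eq {ℓ : Fin (m + 1)} {w : Edge m → ℝ}
    (hw : ∀ S : Finset (Fin (m + 1)), ℓ ∈ S → S ≠ Finset.univ →
      ∑ e ∈ cut Sᶜ, w e < ∑ e ∈ cut S, w e) : regularCells w = triCells ℓ := by
  classical
  ext s
  rw [mem_triCells_iff]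
  constructor
  · rintro ⟨c, c₀, hle, heq⟩ S hS hne
    by_contra! hcon
    -- the slack vanishes on `cut S`, so its flow across the cut cannot be positive
    have h1 : ∑ e ∈ cut S, w e = ∑ e ∈ cut S, (dot m c (rayR e) - c₀) := by
      refine Finset.sum_congr rfl fun e he => ((heq e).2 ?_).symm
      by_contra h
      exact hcon e (Finset.mem_compl.2 h) he
    have h2 : ∑ e ∈ cut Sᶜ, (dot m c (rayR e) - c₀) ≤ ∑ e ∈ cut Sᶜ, w e :=
      Finset.sum_le_sum fun e _ => hle e
    linarith [hw S hS hne, sum_cut_affine c c₀ S]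
  · intro hs
    obtain ⟨T, hT, hTs⟩ := hs.exists_arborescence
    obtain ⟨z, hz, hz0, hex⟩ := IsArborescence.exists_flow hT hTs (b := excess w) fun v hv => by
      have := hw {v}ᶜ (by simpa using hv.symm) (by
        intro h
        have : v ∈ ({v}ᶜ : Finset (Fin (m + 1))) := h ▸ Finset.mem_univ v
        simp at this)
      rw [compl_compl] at this
      rw [excess_eq_cut]
      linarith
    have hbal : ∀ v, v ≠ ℓ → excess (w - z) v = 0 := fun v hv => by
      rw [excess_sub, hex v hv, sub_self]
    obtain ⟨c, hc⟩ := exists_dot_rayR_eq (f := w - z) fun v => by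
      by_cases hv : v = ℓ
      · have := sum_excess (w - z)
        rw [Finset.sum_eq_single ℓ (fun u _ hu => hbal u hu) (by simp)] at this
        rw [hv, this]
      · exact hbal v hv
    refine ⟨c, 0, fun e => ?_, fun e => ?_⟩
    · rw [hc, sub_zero, Pi.sub_apply]
      linarith [hz e]
    · rw [hc, sub_zero, Pi.sub_apply, sub_eq_self, hz0, Finset.mem_compl, not_not]

/-! ### The toric ideal and its Gröbner basis -/

section Toric

open MvPolynomial

variable {σ : Type*} {k : Type*} [Field k]

/-- The coefficients of an element of the toric ideal sum to zero over each degree for the grading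
by the configuration, so no degree contains exactly one monomial of its support. -/
lemma exists_ne_mem_support_of_mem_toricIdeal [Fintype σ] {L : Type*} [AddCommGroup L] {a : σ → L}
    {f : MvPolynomial σ k} (hf : f ∈ toricIdeal k a) {s : σ →₀ ℕ} (hs : s ∈ f.support) :
    ∃ t ∈ f.support, t ≠ s ∧ ∑ i, t i • a i = ∑ i, s i • a i := by
  classical
  let π : MvPolynomial σ k →ₐ[k] AddMonoidAlgebra k L :=
    aeval fun i => AddMonoidAlgebra.single (a i) 1
  have hprod : ∀ n : σ → ℕ, π (∏ i, X i ^ n i) = AddMonoidAlgebra.single (∑ i, n i • a i) 1 := by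
    intro n
    simp only [π, map_prod, map_pow, aeval_X, AddMonoidAlgebra.single_pow, one_pow]
    induction (Finset.univ : Finset σ) using Finset.induction_on with
    | empty => simp [AddMonoidAlgebra.one_def]
    | insert i u hi ih =>
      rw [Finset.prod_insert hi, Finset.sum_insert hi, ih, AddMonoidAlgebra.single_mul_single,
        one_mul]
  have hmono : ∀ (t : σ →₀ ℕ) (c : k),
      π (monomial t c) = AddMonoidAlgebra.single (∑ i, t i • a i) c := by
    intro t c
    rw [← mul_one c, ← smul_eq_mul, ← smul_monomial, map_smul, monomial_eq, C_1, one_mul,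
      Finsupp.prod_fintype _ _ (fun i => pow_zero _), hprod, AddMonoidAlgebra.smul_single]
  have hker : π f = 0 := by
    have : toricIdeal k a ≤ RingHom.ker π := by
      refine Ideal.span_le.2 ?_
      rintro _ ⟨u, hu, rfl⟩
      rw [SetLike.mem_coe, RingHom.mem_ker, map_sub, hprod, hprod, sub_eq_zero]
      congr 1
      rw [← sub_eq_zero, ← Finset.sum_sub_distrib, ← hu]
      refine Finset.sum_congr rfl fun i _ => ?_
      rw [← natCast_zsmul, ← natCast_zsmul, ← sub_smul, Int.toNat_sub_toNat_neg]
    exact this hf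
  by_contra! hcon
  refine mem_support_iff.1 hs ?_
  have h1 : (π f).coeff (∑ i, s i • a i) = coeff s f := by
    have h2 : π f = ∑ t ∈ f.support, π (monomial t (coeff t f)) := by
      rw [← map_sum, ← f.as_sum]
    rw [h2]
    simp only [hmono, AddMonoidAlgebra.coeff_sum, Finsupp.finsetSum_apply,
      AddMonoidAlgebra.coeff_single]
    rw [Finset.sum_eq_single s (fun t ht hne => Finsupp.single_eq_of_ne (hcon t ht hne).symm)
      fun h => absurd hs h, Finsupp.single_eq_same]
  rw [← h1, hker, AddMonoidAlgebra.coeff_zero, Finsupp.zero_apply]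

lemma initialSpan_eq (ord : MonomialOrder σ) (G : Set (MvPolynomial σ k)) :
    initialSpan ord G = Ideal.span
      ((fun s => monomial s (1 : k)) '' {s | ∃ f ∈ G, f ≠ 0 ∧ ord.degree f = s}) := by
  rw [initialSpan]
  congr 1
  ext p
  constructor
  · rintro ⟨f, hf, h0, rfl⟩
    exact ⟨_, ⟨f, hf, h0, rfl⟩, rfl⟩
  · rintro ⟨_, ⟨f, hf, h0, rfl⟩, rfl⟩
    exact ⟨f, hf, h0, rfl⟩

lemma monomial_mem_initialSpan_iff (ord : MonomialOrder σ) (G : Set (MvPolynomial σ k))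
    (t : σ →₀ ℕ) : monomial t (1 : k) ∈ initialSpan ord G ↔
      ∃ f ∈ G, f ≠ 0 ∧ ord.degree f ≤ t := by
  classical
  rw [initialSpan_eq, mem_ideal_span_monomial_image]
  simp [support_monomial, and_assoc]

end Toric

/-- The exponent vector of the squarefree monomial of a set of edges. -/
noncomputable def edgeExp (s : Finset (Edge m)) : Edge m →₀ ℕ := ∑ e ∈ s, Finsupp.single e 1

lemma edgeExp_apply (s : Finset (Edge m)) (e : Edge m) :
    edgeExp s e = if e ∈ s then 1 else 0 := by
  classical
  simp [edgeExp, Finsupp.finsetSum_apply, Finsupp.single_apply]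

lemma prod_X_eq_monomial (k : Type*) [Field k] (s : Finset (Edge m)) :
    ∏ e ∈ s, (MvPolynomial.X e : MvPolynomial (Edge m) k)
      = MvPolynomial.monomial (edgeExp s) 1 := by
  rw [edgeExp, MvPolynomial.monomial_sum_one]
  rfl

lemma cutBinomial_eq (k : Type*) [Field k] (S : Finset (Fin (m + 1))) :
    cutBinomial k S = MvPolynomial.monomial (edgeExp (cut S)) 1
      - MvPolynomial.monomial (edgeExp (cut Sᶜ)) 1 := by
  rw [cutBinomial, prod_X_eq_monomial, prod_X_eq_monomial]

lemma cutBinomial_compl (k : Type*) [Field k] (S : Finset (Fin (m + 1))) :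
    cutBinomial k Sᶜ = - cutBinomial k S := by
  rw [cutBinomial_eq, cutBinomial_eq, compl_compl, neg_sub]

lemma degree_cutBinomial (k : Type*) [Field k] {ord : MonomialOrder (Edge m)}
    {S : Finset (Fin (m + 1))} (h : edgeExp (cut Sᶜ) ≺[ord] edgeExp (cut S)) :
    ord.degree (cutBinomial k S) = edgeExp (cut S) := by
  classical
  rw [cutBinomial_eq, MonomialOrder.degree_sub_of_lt] <;> simp [MonomialOrder.degree_monomial, h]

lemma cutBinomial_ne_zero (k : Type*) [Field k] {ord : MonomialOrder (Edge m)}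
    {S : Finset (Fin (m + 1))} (h : edgeExp (cut Sᶜ) ≺[ord] edgeExp (cut S)) :
    cutBinomial k S ≠ 0 := by
  refine ord.ne_zero_of_degree_ne_zero ?_
  rw [degree_cutBinomial k h]
  intro h0
  rw [h0, map_zero] at h
  exact (ord.zero_le _).not_gt h

lemma cutBinomial_mem_toricIdeal (k : Type*) [Field k] (S : Finset (Fin (m + 1))) :
    cutBinomial k S ∈ toricIdeal k (ray (m := m)) := by
  classical
  let p : Fin (m + 1) → ℤ := fun v => if v ∈ S then 1 else 0
  refine Ideal.subset_span ⟨fun e => p e.1.1 - p e.1.2, ?_, ?_⟩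
  · ext a b
    have := (sum_mul_ray_eq_zero_iff fun e : Edge m => p e.1.1 - p e.1.2).2 ⟨p, fun e => rfl⟩ a b
    rw [Matrix.sum_apply]
    simpa only [Matrix.smul_apply, smul_eq_mul, Int.cast_id, Matrix.zero_apply] using this
  · rw [cutBinomial, cut, cut, Finset.prod_filter, Finset.prod_filter]
    congr 1 <;> refine Finset.prod_congr rfl fun e _ => ?_ <;>
      by_cases h1 : e.1.1 ∈ S <;> by_cases h2 : e.1.2 ∈ S <;> simp [p, h1, h2]

/-- If two monomials differ by an element of the relation lattice, then the larger one is divisible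
by the larger monomial of some cut binomial. The difference is a coboundary `p_i - p_j`, which
decomposes without cancellation into the cuts at the level sets of `p`, and the first monomial of
at least one of these cuts must be the larger one. -/
lemma exists_cut_le {ord : MonomialOrder (Edge m)} {s t : Edge m →₀ ℕ}
    (h : ∑ e, t e • ray e = ∑ e, s e • ray e) (hlt : t ≺[ord] s) :
    ∃ S : Finset (Fin (m + 1)), edgeExp (cut Sᶜ) ≺[ord] edgeExp (cut S) ∧ edgeExp (cut S) ≤ s := by
  classical
  obtain ⟨p, hp⟩ := (sum_mul_ray_eq_zero_iff fun e => (s e : ℤ) - t e).1 fun a b => by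
    have h1 := congrFun (congrFun h a) b
    rw [Matrix.sum_apply, Matrix.sum_apply] at h1
    simp only [Matrix.smul_apply] at h1
    simp only [nsmul_eq_mul] at h1
    simp only [Int.cast_id, sub_mul, Finset.sum_sub_distrib]
    linarith
  obtain ⟨lo, hlo⟩ := (Set.finite_range p).bddBelow
  obtain ⟨hi, hhi⟩ := (Set.finite_range p).bddAbove
  let S : ℤ → Finset (Fin (m + 1)) := fun c => Finset.univ.filter fun v => c ≤ p v
  -- the number of level sets separating `i` from `j` is the positive part of `p i - p j`
  have hcount : ∀ i j, ∑ c ∈ Finset.Ioc lo hi, (if c ≤ p i ∧ p j < c then 1 else 0)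
      = (p i - p j).toNat := fun i j => by
    rw [← Int.card_Ioc, Finset.card_eq_sum_ones, ← Finset.sum_filter]
    refine Finset.sum_congr ?_ fun _ _ => rfl
    ext c
    have h1 := hlo (Set.mem_range_self j)
    have h2 := hhi (Set.mem_range_self i)
    simp only [Finset.mem_filter, Finset.mem_Ioc]
    omega
  have hA : ∀ e, (∑ c ∈ Finset.Ioc lo hi, edgeExp (cut (S c))) e = (p e.1.1 - p e.1.2).toNat :=
    fun e => by
      rw [← hcount, Finsupp.finsetSum_apply]
      refine Finset.sum_congr rfl fun c _ => ?_
      simp [edgeExp_apply, S]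
  have hB : ∀ e, (∑ c ∈ Finset.Ioc lo hi, edgeExp (cut (S c)ᶜ)) e = (p e.1.2 - p e.1.1).toNat :=
    fun e => by
      rw [← hcount, Finsupp.finsetSum_apply]
      refine Finset.sum_congr rfl fun c _ => ?_
      simp [edgeExp_apply, S, and_comm]
  by_contra! hcon
  have hle : ∀ c, edgeExp (cut (S c)) ≼[ord] edgeExp (cut (S c)ᶜ) := fun c => by
    by_contra! hc
    refine hcon (S c) hc fun e => ?_
    have h1 := hp e
    rw [edgeExp_apply]
    split_ifs with he
    · simp only [mem_cut, S, Finset.mem_filter, Finset.mem_univ, true_and] at he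
      omega
    · exact Nat.zero_le _
  have hsum : s + ∑ c ∈ Finset.Ioc lo hi, edgeExp (cut (S c)ᶜ)
      = t + ∑ c ∈ Finset.Ioc lo hi, edgeExp (cut (S c)) := by
    ext e
    rw [Finsupp.add_apply, Finsupp.add_apply, hA, hB]
    have := hp e
    omega
  have h1 := congrArg ord.toSyn hsum
  rw [map_add, map_add, map_sum, map_sum] at h1
  have h2 : ∑ c ∈ Finset.Ioc lo hi, ord.toSyn (edgeExp (cut (S c)))
      ≤ ∑ c ∈ Finset.Ioc lo hi, ord.toSyn (edgeExp (cut (S c)ᶜ)) :=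
    Finset.sum_le_sum fun c _ => hle c
  exact (add_lt_add_of_lt_of_le hlt h2).ne h1.symm

lemma Gr_isGroebnerBasis (k : Type*) [Field k] (ℓ : Fin (m + 1)) (ord : MonomialOrder (Edge m)) :
    IsGroebnerBasis ord (toricIdeal k (ray (m := m))) (Gr k ℓ) := by
  have hsub : Gr k ℓ ⊆ (toricIdeal k (ray (m := m)) : Set (MvPolynomial (Edge m) k)) := by
    rintro _ ⟨S, -, -, rfl⟩
    exact cutBinomial_mem_toricIdeal k S
  refine ⟨?_, hsub, le_antisymm (Ideal.span_mono ?_) (Ideal.span_le.2 ?_)⟩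
  · refine (Set.finite_range (cutBinomial (m := m) k)).subset ?_
    rintro _ ⟨S, -, -, rfl⟩
    exact ⟨S, rfl⟩
  · rintro _ ⟨f, hf, h0, rfl⟩
    exact ⟨f, hsub hf, h0, rfl⟩
  · rintro _ ⟨f, hf, h0, rfl⟩
    rw [SetLike.mem_coe, monomial_mem_initialSpan_iff]
    obtain ⟨t, ht, hne, heq⟩ :=
      exists_ne_mem_support_of_mem_toricIdeal hf (ord.degree_mem_support h0)
    have hlt : t ≺[ord] ord.degree f :=
      (ord.le_degree ht).lt_of_ne fun h => hne (ord.toSyn.injective h)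
    obtain ⟨S, hS, hle⟩ := exists_cut_le heq hlt
    have hcut : cut S ≠ cut Sᶜ := fun h => hS.ne (by rw [h])
    have hdeg := degree_cutBinomial k hS
    have hne0 := cutBinomial_ne_zero k hS
    -- `Gr` contains the binomial of the cut up to sign, whichever side `ℓ` is on
    by_cases hℓ : ℓ ∈ S
    · refine ⟨_, ⟨S, hℓ, ?_, rfl⟩, hne0, hdeg ▸ hle⟩
      rintro rfl
      refine hcut ?_
      ext e
      simp
    · refine ⟨_, ⟨Sᶜ, by simpa using hℓ, ?_, rfl⟩, ?_, ?_⟩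
      · intro h
        refine hcut ?_
        rw [h]
        ext e
        rw [← compl_compl S, h]
        simp
      · rw [cutBinomial_compl]
        exact neg_ne_zero.2 hne0
      · rw [cutBinomial_compl, MonomialOrder.degree_neg, hdeg]
        exact hle

lemma initialComplex_eq {k : Type*} [Field k] {ℓ : Fin (m + 1)} {ord : MonomialOrder (Edge m)}
    (hord : SelectsOutgoing k ord ℓ) :
    initialComplex ord (toricIdeal k (ray (m := m))) = triCells ℓ := by
  classical
  ext s
  rw [mem_triCells_iff, initialComplex, ← (Gr_isGroebnerBasis k ℓ ord).2.2, Set.mem_ofPred_eq,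
    ← not_iff_not, not_not, prod_X_eq_monomial, Ideal.mem_radical_iff]
  simp only [MvPolynomial.monomial_pow, one_pow, monomial_mem_initialSpan_iff]
  constructor
  · rintro ⟨N, _, ⟨S, hS, hne, rfl⟩, -, hle⟩ hspan
    obtain ⟨e, he, hc⟩ := hspan S hS hne
    have h1 : edgeExp (cut S) e ≤ (N • edgeExp s) e := by
      have hdeg : ord.degree (cutBinomial k S) = edgeExp (cut S) := hord S hS hne
      exact hdeg ▸ hle e
    rw [Finsupp.smul_apply, edgeExp_apply, edgeExp_apply, if_pos hc,
      if_neg (Finset.mem_compl.1 he)] at h1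
    simp at h1
  · intro hspan
    simp only [IsSpanning, not_forall, not_exists, not_and] at hspan
    obtain ⟨S, hS, hne, hcon⟩ := hspan
    have hdeg : ord.degree (cutBinomial k S) = edgeExp (cut S) := hord S hS hne
    refine ⟨1, _, ⟨S, hS, hne, rfl⟩, ord.ne_zero_of_degree_ne_zero ?_, ?_⟩
    · obtain ⟨v, hv⟩ : ∃ v, v ∉ S := by
        by_contra! h
        exact hne (Finset.eq_univ_of_forall h)
      rw [hdeg]
      intro h0
      have hℓv : ℓ ≠ v := fun h => hv (h ▸ hS)
      have := DFunLike.congr_fun h0 (⟨(ℓ, v), hℓv⟩ : Edge m)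
      simp [edgeExp_apply, hS, hv] at this
    · rw [hdeg, one_smul]
      intro e
      rw [edgeExp_apply, edgeExp_apply]
      by_cases he : e ∈ cut S
      · have : e ∈ s := by
          by_contra h
          exact hcon e (Finset.mem_compl.2 h) he
        simp [this, he]
      · simp [he]

/-! ### Term orders in which the edges at the root dominate -/

lemma RootDominates.selectsOutgoing (k : Type*) [Field k] {ℓ : Fin (m + 1)}
    {ord : MonomialOrder (Edge m)} (h : RootDominates ord ℓ) : SelectsOutgoing k ord ℓ := by
  classical
  intro S hS hne
  obtain ⟨v, hv⟩ : ∃ v, v ∉ S := by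
    by_contra! h
    exact hne (Finset.eq_univ_of_forall h)
  have hℓv : ℓ ≠ v := fun h => hv (h ▸ hS)
  refine degree_cutBinomial k ((h ⟨(ℓ, v), hℓv⟩ rfl _ fun f hf => ?_).trans_le
    (ord.toSyn_monotone ?_))
  · rw [Finsupp.mem_support_iff, edgeExp_apply] at hf
    have : f ∈ cut Sᶜ := by
      by_contra hc
      exact hf (if_neg hc)
    rintro rfl
    simp [hS] at this
  · rw [Finsupp.single_le_iff, edgeExp_apply, if_pos (by simp [hS, hv])]

/-- A copy of the edge set, ordered lexicographically except that the edges leaving `ℓ` come first.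
In the lexicographic term order the variables of the first indices are the largest. -/
def RootFirst (_ : Fin (m + 1)) : Type := Edge m

noncomputable instance (ℓ : Fin (m + 1)) : LinearOrder (RootFirst ℓ) :=
  LinearOrder.lift' (fun e : Edge m => toLex (decide (e.1.1 ≠ ℓ), toLex e.1)) fun _ _ h =>
    Subtype.ext (congrArg (fun x : Bool ×ₗ (Fin (m + 1) ×ₗ Fin (m + 1)) => ofLex (ofLex x).2) h)

instance (ℓ : Fin (m + 1)) : Finite (RootFirst ℓ) := inferInstanceAs (Finite (Edge m))

lemma RootFirst.eq_of_lt {ℓ : Fin (m + 1)} {e f : Edge m}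
    (h : @LT.lt (RootFirst ℓ) _ f e) (he : e.1.1 = ℓ) : f.1.1 = ℓ := by
  have h' : toLex (decide (f.1.1 ≠ ℓ), toLex f.1) < toLex (decide (e.1.1 ≠ ℓ), toLex e.1) := h
  by_contra hf
  have hf' : decide (f.1.1 ≠ ℓ) = true := decide_eq_true hf
  have he' : decide (e.1.1 ≠ ℓ) = false := decide_eq_false (not_not.2 he)
  rw [hf', he', Prod.Lex.toLex_lt_toLex] at h'
  rcases h' with h' | h'
  · exact absurd (show true < false from h') (by decide)
  · exact absurd (show true = false from h'.1) (by decide)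

lemma exists_rootDominates (ℓ : Fin (m + 1)) :
    ∃ ord : MonomialOrder.{0, 0} (Edge m), RootDominates ord ℓ := by
  classical
  refine ⟨(MonomialOrder.lex : MonomialOrder (RootFirst ℓ)), fun e he a ha => ?_⟩
  have ha0 : ∀ f : Edge m, f.1.1 = ℓ → a f = 0 := fun f hf => by
    by_contra h
    exact ha f (Finsupp.mem_support_iff.2 h) hf
  refine (Finsupp.lex_def (α := RootFirst ℓ)).2 ⟨e, fun f hf => ?_, ?_⟩
  · have hne : f ≠ e := hf.ne
    refine (ha0 f (RootFirst.eq_of_lt hf he)).trans ?_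
    exact (Finsupp.single_eq_of_ne hne).symm
  · refine (ha0 e he).trans_lt ?_
    exact one_pos.trans_eq (Finsupp.single_eq_same (a := e) (b := 1)).symm

end BirkhoffCone

theorem mainTheorem3 (m : ℕ) (ℓ : Fin (m + 1)) (k : Type*) [Field k] :
    -- the dual cone is generated by the whole configuration
    dualCone m = PointedCone.hull ℝ (Set.range (rayR (m := m))) ∧
    -- the cones of the `ℓ`-arborescences are distinct, triangulate it, and are unimodular
    Set.InjOn (coneD (m := m)) (Arb ℓ) ∧
    IsTriangulation (dualCone m) (coneD '' Arb ℓ) ∧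
    (∀ T ∈ Arb ℓ, IsUnimodular (coneD T)) ∧
    -- the term orders in question exist and have the stated initial monomials
    (∃ ord : MonomialOrder.{0, 0} (Edge m), RootDominates ord ℓ) ∧
    (∀ ord : MonomialOrder (Edge m), RootDominates ord ℓ → SelectsOutgoing k ord ℓ) ∧
    -- `Gr_ℓ` is a Gröbner basis, and the triangulation it induces is the one above
    (∀ ord : MonomialOrder (Edge m),
      IsGroebnerBasis ord (toricIdeal k (ray (m := m))) (Gr k ℓ)) ∧
    (∀ ord : MonomialOrder (Edge m), SelectsOutgoing k ord ℓ →
      initialComplex ord (toricIdeal k (ray (m := m))) = triCells ℓ) ∧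
    -- it is the regular triangulation for all weights selecting these initial monomials
    (∀ w : Edge m → ℝ,
      (∀ S : Finset (Fin (m + 1)), ℓ ∈ S → S ≠ Finset.univ →
        ∑ e ∈ cut Sᶜ, w e < ∑ e ∈ cut S, w e) →
      regularCells w = triCells ℓ) := by
  rw [hull_range_rayR, dualCone_eq]
  exact ⟨rfl, coneD_injOn ℓ, coneD_isTriangulation ℓ, fun T hT => coneD_isUnimodular hT,
    exists_rootDominates ℓ, fun ord h => h.selectsOutgoing k, Gr_isGroebnerBasis k ℓ,
    fun ord h => initialComplex_eq h, fun w hw => regularCells_eq hw⟩
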